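/- Let $\{y^\alpha\}_{\alpha\in F}$ be a finite set of free fields on four-dimensional Minkowski space with metric $\eta=\mathrm{diag}(1,-1,-1,-1)$; each $y^\alpha$ has a Grassmann parity and a mass $m_\alpha\ge 0$ (the massless case is $m_\alpha=0$ for all $\alpha$). Write $y^A$ for any of the fields or their derivatives $y^\alpha_{\mu_1\dots\mu_k}$ (symmetric in the $\mu$'s, $k\ge 0$), let $m_A=m_\alpha$, and let $\epsilon_{AB}=-1$ if $y^A,y^B$ are both Grassmann odd and $\epsilon_{AB}=+1$ otherwise. The algebra of on-shell polynomials is the complex algebra generated by the $y^A$ with the relations $y^Ay^B=\epsilon_{AB}\,y^By^A$ and $\eta^{\mu\nu}y^\alpha_{\mu\nu\rho_1\dots\rho_k}=-m_\alpha^2\,y^\alpha_{\rho_1\dots\rho_k}$. Let $d_\mu$ be its derivation with $d_\mu y^\alpha_{\nu_1\dots\nu_k}=y^\alpha_{\mu\nu_1\dots\nu_k}$, and $d^\mu=\eta^{\mu\nu}d_\nu$. The canonical dimension of a monomial is the number of its factors plus the total number of derivatives. Let $S^{I;\mu}$ be a family of on-shell polynomials, $I$ running through any index set. Below, $S^{I;\mu\nu}$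 denotes on-shell polynomials with $S^{I;\mu\nu}=-S^{I;\nu\mu}$, and $c$'s denote complex constants. 1. If all terms of $S^{I;\mu}$ have canonical dimension $\ge 4$ and at least three factors, and $d_\mu S^{I;\mu}=0$, then $S^{I;\mu}$ is trivial: $S^{I;\mu}=d_\nu S^{I;\mu\nu}$ for some such $S^{I;\mu\nu}$. 2. If all terms of $S^{I;\mu}$ have canonical dimension $\ge 4$ (without trilinearity), then $d_\mu S^{I;\mu}=0$ if and only if $$S^{I;\mu}=\sum_{A,B}c^I_{AB}\,y^A\,d^\mu y^B+\sum_A c^I_A\,d^\mu y^A+d_\nu S^{I;\mu\nu}$$ for some $S^{I;\mu\nu}$ and some constants, finitely many of them non-zero for each $I$, with $c^I_{AB}=-\epsilon_{AB}\,c^I_{BA}$, with $c^I_{AB}=0$ unless $m_A=m_B$, and with $c^I_A=0$ unless $m_A=0$. 3. If $S^{I;\mu}$ is a linear combination of monomials of canonical dimension $2$, then $d_\mu S^{I;\mu}=0$ if and only if $S^{I;\mu}=\sum_\alpha c^I_\alpha\,d^\mu y^\alpha+d_\nu S^{I;\mu\nu}$ for some $S^{I;\mu\nu}$ and some constants with $c^I_\alpha=0$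 unless $m_\alpha=0$. 4. If $S^{I;\mu}$ is a linear combination of monomials of canonical dimension $3$, then $d_\mu S^{I;\mu}=0$ if and only if $$S^{I;\mu}=\sum_{\alpha,\beta}c^I_{\alpha\beta}\,y^\alpha\,d^\mu y^\beta+\sum_{\alpha}c^{I\nu}_\alpha\,d^\mu d_\nu y^\alpha+d_\nu S^{I;\mu\nu}$$ for some $S^{I;\mu\nu}$ and some constants with $c^I_{\alpha\beta}=-\epsilon_{\alpha\beta}\,c^I_{\beta\alpha}$, with $c^I_{\alpha\beta}=0$ unless $m_\alpha=m_\beta$, and with $c^{I\nu}_\alpha=0$ unless $m_\alpha=0$. -/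

import Mathlib

open scoped NNReal

noncomputable section

namespace OnShellJets

/-- The Minkowski metric on four-dimensional space-time, with diagonal `(1, -1, -1, -1)`. -/
def eta : Matrix (Fin 4) (Fin 4) ℂ := Matrix.diagonal ![1, -1, -1, -1]

/-- Labels of the jet coordinates: the pair `(α, {μ₁, …, μₖ})` labels
`y^α_{μ₁ … μₖ} = d_{μ₁} … d_{μₖ} y^α`. Multisets account for the symmetry in the `μ`'s. -/
abbrev Jet (F : Type*) := F × Multiset (Fin 4)

/-- The label of `d_μ y^A`. -/
def Jet.diff {F : Type*} (μ : Fin 4) (A : Jet F) : Jet F := (A.1, μ ::ₘ A.2)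

variable {F : Type*}

/-- The sign `(-1)^{ε_α ε_β}`, where `odd α` says that the field `y^α` is Grassmann odd. -/
def fieldSign (odd : F → Bool) (α β : F) : ℂ := if odd α && odd β then -1 else 1

/-- Defining relations of the on-shell polynomials: graded commutativity of the variables `y^A`,
and the Klein-Gordon equation `d^μ d_μ y^α = - m_α² y^α` with all its differential consequences. -/
inductive OnShellRel (odd : F → Bool) (m : F → ℝ≥0) :
    FreeAlgebra ℂ (Jet F) → FreeAlgebra ℂ (Jet F) → Prop
  | graded_comm (A B : Jet F) :
      OnShellRel odd m (FreeAlgebra.ι ℂ A * FreeAlgebra.ι ℂ B)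
        (fieldSign odd A.1 B.1 • (FreeAlgebra.ι ℂ B * FreeAlgebra.ι ℂ A))
  | klein_gordon (A : Jet F) :
      OnShellRel odd m
        (∑ μ, ∑ ν, eta μ ν • FreeAlgebra.ι ℂ ((A.diff ν).diff μ))
        ((-(((m A.1 : ℝ) : ℂ) ^ 2)) • FreeAlgebra.ι ℂ A)

/-- The algebra of (graded commutative) polynomials, with complex constant coefficients, in the
fields `y^α` and their derivatives, restricted to the mass shell. -/
def OnShellPoly (odd : F → Bool) (m : F → ℝ≥0) := RingQuot (OnShellRel odd m)

variable (odd : F → Bool) (m : F → ℝ≥0)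

instance : Ring (OnShellPoly odd m) := inferInstanceAs (Ring (RingQuot (OnShellRel odd m)))

instance : Algebra ℂ (OnShellPoly odd m) :=
  inferInstanceAs (Algebra ℂ (RingQuot (OnShellRel odd m)))

/-- The quotient map from the free algebra. -/
def mk : FreeAlgebra ℂ (Jet F) →ₐ[ℂ] OnShellPoly odd m :=
  RingQuot.mkAlgHom ℂ (OnShellRel odd m)

theorem mk_rel ⦃a b : FreeAlgebra ℂ (Jet F)⦄ (h : OnShellRel odd m a b) :
    mk odd m a = mk odd m b :=
  RingQuot.mkAlgHom_rel ℂ h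

/-- The universal property of the quotient. -/
def lift {B : Type*} [Semiring B] [Algebra ℂ B] (f : FreeAlgebra ℂ (Jet F) →ₐ[ℂ] B)
    (hf : ∀ ⦃a b⦄, OnShellRel odd m a b → f a = f b) : OnShellPoly odd m →ₐ[ℂ] B :=
  RingQuot.liftAlgHom ℂ ⟨f, hf⟩

theorem lift_mk {B : Type*} [Semiring B] [Algebra ℂ B] (f : FreeAlgebra ℂ (Jet F) →ₐ[ℂ] B)
    (hf : ∀ ⦃a b⦄, OnShellRel odd m a b → f a = f b) (x : FreeAlgebra ℂ (Jet F)) :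
    lift odd m f hf (mk odd m x) = f x :=
  RingQuot.liftAlgHom_mkAlgHom_apply ℂ f hf x

theorem mk_surjective : Function.Surjective (mk odd m) :=
  RingQuot.mkAlgHom_surjective ℂ (OnShellRel odd m)

/-- The variable `y^A` as an on-shell polynomial. -/
def y (A : Jet F) : OnShellPoly odd m := mk odd m (FreeAlgebra.ι ℂ A)

theorem y_mul_y (A B : Jet F) :
    y odd m A * y odd m B = fieldSign odd A.1 B.1 • (y odd m B * y odd m A) := by
  have h := mk_rel odd m (OnShellRel.graded_comm A B)
  simpa [y] using h

theorem klein_gordon (A : Jet F) :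
    ∑ μ, ∑ ν, eta μ ν • y odd m ((A.diff ν).diff μ)
      = (-(((m A.1 : ℝ) : ℂ) ^ 2)) • y odd m A := by
  have h := mk_rel odd m (OnShellRel.klein_gordon A)
  simpa only [y, map_sum, map_smul] using h

/-- The algebra homomorphism `p ↦ p + ε d_μ p` into the dual numbers over the on-shell polynomials,
first on the free algebra; multiplicativity encodes the Leibniz rule for `d_μ`. -/
def dualLiftFree (μ : Fin 4) :
    FreeAlgebra ℂ (Jet F) →ₐ[ℂ] DualNumber (OnShellPoly odd m) :=
  FreeAlgebra.lift ℂ fun A =>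
    TrivSqZeroExt.inl (y odd m A) + TrivSqZeroExt.inr (y odd m (A.diff μ))

theorem dualLiftFree_rel (μ : Fin 4) ⦃a b : FreeAlgebra ℂ (Jet F)⦄
    (h : OnShellRel odd m a b) : dualLiftFree odd m μ a = dualLiftFree odd m μ b := by
  induction h with
  | graded_comm A B =>
    have h1 := y_mul_y odd m A B
    have h2 := y_mul_y odd m (A.diff μ) B
    have h3 := y_mul_y odd m A (B.diff μ)
    ext
    · simpa [dualLiftFree] using h1
    · simp only [Jet.diff] at h2 h3
      simp only [dualLiftFree, map_mul, map_smul, FreeAlgebra.lift_ι_apply, Jet.diff,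
        TrivSqZeroExt.snd_mul, TrivSqZeroExt.snd_smul, TrivSqZeroExt.snd_add,
        TrivSqZeroExt.snd_inl, TrivSqZeroExt.snd_inr, TrivSqZeroExt.fst_add,
        TrivSqZeroExt.fst_inl, TrivSqZeroExt.fst_inr, zero_add, add_zero, smul_eq_mul,
        MulOpposite.smul_eq_mul_unop, MulOpposite.unop_op, h2, h3, smul_add]
      rw [add_comm]
  | klein_gordon A =>
    have h1 := klein_gordon odd m A
    have h2 := klein_gordon odd m (A.diff μ)
    have h3 : ∀ ρ ν : Fin 4, ((A.diff ν).diff ρ).diff μ = ((A.diff μ).diff ν).diff ρ := by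
      intro ρ ν
      simp only [Jet.diff, Prod.mk.injEq, true_and]
      rw [Multiset.cons_swap μ ρ, Multiset.cons_swap μ ν]
    ext
    · simpa [dualLiftFree, TrivSqZeroExt.fst_sum, neg_smul] using h1
    · simpa [dualLiftFree, TrivSqZeroExt.snd_sum, h3, Jet.diff, neg_smul,
        Multiset.cons_swap μ] using h2

/-- The homomorphism `p ↦ p + ε d_μ p` on the on-shell polynomials. -/
def dualLift (μ : Fin 4) : OnShellPoly odd m →ₐ[ℂ] DualNumber (OnShellPoly odd m) :=
  lift odd m (dualLiftFree odd m μ) (dualLiftFree_rel odd m μ)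

/-- The formal derivative `d_μ`: the (even) derivation of the algebra of on-shell polynomials with
`d_μ y^α_{ν₁ … νₖ} = y^α_{μ ν₁ … νₖ}`; see `d_y` and `d_mul`. -/
def d (μ : Fin 4) : OnShellPoly odd m →ₗ[ℂ] OnShellPoly odd m :=
  TrivSqZeroExt.sndHom (OnShellPoly odd m) (OnShellPoly odd m) |>.restrictScalars ℂ |>.comp
    (dualLift odd m μ).toLinearMap

variable {odd m}

theorem d_y (μ : Fin 4) (A : Jet F) : d odd m μ (y odd m A) = y odd m (A.diff μ) := by
  simp [d, dualLift, y, lift_mk, dualLiftFree]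

theorem fst_dualLift (μ : Fin 4) (p : OnShellPoly odd m) :
    (dualLift odd m μ p).fst = p := by
  have h : ((TrivSqZeroExt.fstHom ℂ (OnShellPoly odd m) (OnShellPoly odd m)).comp
      (dualLift odd m μ)).comp (mk odd m) = mk odd m := by
    ext A
    simp [dualLift, lift_mk, dualLiftFree, y]
  obtain ⟨x, rfl⟩ := mk_surjective odd m p
  exact DFunLike.congr_fun h x

theorem d_mul (μ : Fin 4) (p q : OnShellPoly odd m) :
    d odd m μ (p * q) = d odd m μ p * q + p * d odd m μ q := by
  simp [d, fst_dualLift, add_comm]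

variable (odd m)

/-- The formal derivative `d^μ` with raised index. -/
def dUp (μ : Fin 4) : OnShellPoly odd m →ₗ[ℂ] OnShellPoly odd m := ∑ ν, eta μ ν • d odd m ν

/-- The Wick monomial `y^{A₁} ⋯ y^{Aₙ}`. -/
def mono (l : List (Jet F)) : OnShellPoly odd m := (l.map (y odd m)).prod

/-- The canonical dimension of a monomial: each field and each derivative contributes `1`. -/
def canonicalDim (l : List (Jet F)) : ℕ := (l.map fun A => 1 + Multiset.card A.2).sum

/-- The expressions of canonical dimension (exactly) `ω`. -/
def dimEq (ω : ℕ) : Submodule ℂ (OnShellPoly odd m) :=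
  Submodule.span ℂ (mono odd m '' {l | canonicalDim l = ω})

/-- The expressions all of whose terms have canonical dimension at least `ω`. -/
def dimGE (ω : ℕ) : Submodule ℂ (OnShellPoly odd m) :=
  Submodule.span ℂ (mono odd m '' {l | ω ≤ canonicalDim l})

/-- The expressions all of whose terms have at least `n` factors (fields or derivatives). -/
def degGE (n : ℕ) : Submodule ℂ (OnShellPoly odd m) :=
  Submodule.span ℂ (mono odd m '' {l | n ≤ l.length})

variable {odd m}

/-- `d_μ S^μ = 0`. -/
def DivFree (S : Fin 4 → OnShellPoly odd m) : Prop := ∑ μ, d odd m μ (S μ) = 0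

/-- Antisymmetry `T^{μν} = - T^{νμ}`. -/
def Antisymm (T : Fin 4 → Fin 4 → OnShellPoly odd m) : Prop := ∀ μ ν, T μ ν = -T ν μ

/-- The divergence `d_ν T^{μν}`. -/
def divergence (T : Fin 4 → Fin 4 → OnShellPoly odd m) (μ : Fin 4) : OnShellPoly odd m :=
  ∑ ν, d odd m ν (T μ ν)

end OnShellJets

end

open OnShellJets

noncomputable section

open MvPolynomial

namespace OnShellJets

/-! ### Koszul syzygies and coprime leading monomials -/

section Koszul

/-! Fix an ordered list of `n` fields. A word of jet coordinates on these fields is a monomial in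
`n` momenta `p_i`, the derivative `d_μ` is multiplication by the total momentum `P_μ = ∑ p_i`, and
the Klein-Gordon equation is `p_i² + m_i² = 0`, squares being taken with the metric. A conserved
current becomes a vector `t` of polynomials with `P·t` in the mass shell ideal, and it is trivial if
`t^μ = P_ν T^{μν}` modulo that ideal with `T` antisymmetric. The theorem thus asks which syzygies of
`P` on the mass shell are not Koszul, and the answer depends on `n`.

For `n ≥ 3` there are none. Once `p_0` is eliminated with the help of `P`, the components of `P` and
the mass shell polynomials have pairwise coprime leading monomials for a suitable weight, so all
their syzygies are Koszul (`koszul_of_coprime_leading`, `exists_trivial_many`). For `n = 2` there is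
the relation `p_1² - p_0² = P·(p_1 - p_0)`. If the masses differ, `P·(p_0 - p_1)` is a nonzero
constant on shell and every current is trivial (`exists_trivial_two`); if they agree, one mass shell
polynomial is redundant modulo `P`, and the redundancy gives the vectors `(p_1 - p_0) b`, that is,
the bilinear currents (`exists_form_two`). For `n = 1`, `P·p_0 = p_0²` is a nonzero constant in the
massive case, and gives the vectors `p_0 g`, the linear currents, in the massless case. The
constants, `n = 0`, are excluded by the canonical dimension. In dimensions two and three a degree
argument restricts `g` and `b` further.

To reach polynomials from an algebra given by generators and signed relations, this algebra is
represented on words modulo Klein-Gordon, each variable acting by signed insertion into all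
positions. Acting on the empty word gives the signed symmetrization, so a vanishing element has its
symmetrization in the Klein-Gordon span (`sym_mem_of_wordEval_eq_zero`). Dividing by `n!` gives
symmetric representatives of any current, for which conservation holds separately for each ordered
list of fields, with no signs left (`exists_conserved_representatives`).

The converse is a direct computation: `d_μ (y^A d^μ y^B)` is graded symmetric in `A` and `B` when
the masses agree, so it cancels against graded antisymmetric coefficients. -/

theorem sum_sum_antisymm {A J : Type*} [CommRing A] [IsDomain A] [CharZero A]
    {T : J → J → A} (hT : ∀ j k, T j k = -T k j) (g : J → A) (s : Finset J) :
    ∑ j ∈ s, (∑ k ∈ s, T j k * g k) * g j = 0 := by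
  have h : ∑ j ∈ s, (∑ k ∈ s, T j k * g k) * g j
      = -∑ j ∈ s, (∑ k ∈ s, T j k * g k) * g j := by
    conv_lhs => simp only [Finset.sum_mul]; rw [Finset.sum_comm]
    simp only [Finset.sum_mul, ← Finset.sum_neg_distrib]
    refine Finset.sum_congr rfl fun j _ => Finset.sum_congr rfl fun k _ => ?_
    rw [hT k j]; ring
  exact self_eq_neg.mp h

/-- Syzygies of a family which is regular in every order are generated by the Koszul syzygies. -/
theorem koszul_of_regular {A J : Type*} [CommRing A] (g : J → A)
    (hreg : ∀ (s : Finset J) (j : J), j ∉ s → ∀ h, h * g j ∈ Ideal.span (g '' s) →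
      h ∈ Ideal.span (g '' s)) (s : Finset J) :
    ∀ a : J → A, ∑ j ∈ s, a j * g j = 0 →
      ∃ T : J → J → A, (∀ j k, T j k = -T k j) ∧ ∀ j ∈ s, a j = ∑ k ∈ s, T j k * g k := by
  classical
  induction s using Finset.induction_on with
  | empty => exact fun a _ => ⟨0, by simp, by simp⟩
  | insert i s hi ih =>
    intro a ha
    rw [Finset.sum_insert hi] at ha
    have hmem : a i * g i ∈ Ideal.span (g '' s) := by
      rw [eq_neg_of_add_eq_zero_left ha]
      refine neg_mem (Ideal.sum_mem _ fun j hj => Ideal.mul_mem_left _ _ ?_)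
      exact Ideal.subset_span ⟨j, hj, rfl⟩
    obtain ⟨c, hc⟩ :=
      (Submodule.mem_span_image_finset_iff_exists_fun' _).mp (hreg s i hi _ hmem)
    simp only [smul_eq_mul] at hc
    -- Since `a i = ∑ c k * g k`, the `i`-th term of the relation can be distributed over `s`. The
    -- matrix chosen below has `c` as its row `i`, and hence `-c` as its column `i`.
    obtain ⟨T, hT, hTa⟩ := ih (fun j => a j + c j * g i) (by
      rw [← ha, ← hc, Finset.sum_mul, ← Finset.sum_add_distrib]
      refine Finset.sum_congr rfl fun j _ => by ring)
    refine ⟨fun j k => if j = i then (if k = i then 0 else c k)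
      else if k = i then -c j else T j k, fun j k => ?_, fun j hj => ?_⟩
    · by_cases h1 : j = i <;> by_cases h2 : k = i <;> simp [h1, h2, hT j k]
    · have hne : ∀ k ∈ s, k ≠ i := fun k hk h => hi (h ▸ hk)
      rw [Finset.sum_insert hi]
      rcases Finset.mem_insert.mp hj with rfl | hj
      · simp only [if_true, zero_mul, zero_add]
        rw [← hc]
        exact Finset.sum_congr rfl fun k hk => by rw [if_neg (hne k hk)]
      · simp only [if_neg (hne j hj), if_true]
        have hs : ∑ k ∈ s, (if k = i then -c j else T j k) * g k = ∑ k ∈ s, T j k * g k :=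
          Finset.sum_congr rfl fun k hk => by rw [if_neg (hne k hk)]
        rw [hs, ← hTa j hj]
        ring

variable {σ J k : Type*} [Field k]

/-- Coprime monomials are regular in every order: if the monomial of `u i` divides the product of
that of `u j` with another monomial, it already divides the latter. -/
theorem koszul_monomial (u : J → σ →₀ ℕ) (hu : Pairwise fun i j => Disjoint (u i) (u j))
    (s : Finset J) (a : J → MvPolynomial σ k) (ha : ∑ j ∈ s, a j * monomial (u j) 1 = 0) :
    ∃ T : J → J → MvPolynomial σ k, (∀ i j, T i j = -T j i) ∧
      ∀ i ∈ s, a i = ∑ j ∈ s, T i j * monomial (u j) 1 := by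
  refine koszul_of_regular (fun j => monomial (u j) (1 : k)) (fun s j hj h hh => ?_) s a ha
  have himg : (fun j => monomial (u j) (1 : k)) '' (s : Set J)
      = (fun m => monomial m (1 : k)) '' (u '' s) := by rw [Set.image_image]
  rw [himg, mem_ideal_span_monomial_image] at hh ⊢
  intro m hm
  obtain ⟨_, ⟨i, hi, rfl⟩, hle⟩ := hh (m + u j) (by
    rw [mem_support_iff, coeff_mul_monomial]; simpa using hm)
  refine ⟨_, ⟨i, hi, rfl⟩, fun x => ?_⟩
  have hd := DFunLike.congr_fun (disjoint_iff.mp (hu (show i ≠ j from fun h => hj (h ▸ hi)))) x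
  have hx := hle x
  simp only [Finsupp.inf_apply, bot_eq_zero, Finsupp.coe_zero, Pi.zero_apply,
    Finsupp.coe_add, Pi.add_apply] at hd hx
  omega

/-- The part of `p` of weight `N - c`, which is zero if `N < c`. -/
def weightPart (w : σ → ℕ) (c N : ℕ) : MvPolynomial σ k →ₗ[k] MvPolynomial σ k :=
  if c ≤ N then weightedHomogeneousComponent w (N - c) else 0

theorem coeff_weightPart (w : σ → ℕ) (c N : ℕ) (p : MvPolynomial σ k) (m : σ →₀ ℕ) :
    coeff m (weightPart w c N p) = if Finsupp.weight w m + c = N then coeff m p else 0 := by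
  classical
  unfold weightPart
  split_ifs with h1 h2 h2
  · rw [coeff_weightedHomogeneousComponent, if_pos (by omega)]
  · rw [coeff_weightedHomogeneousComponent, if_neg (by omega)]
  · omega
  · simp

theorem weightPart_mul_monomial (w : σ → ℕ) (c N : ℕ) (p : MvPolynomial σ k) (u : σ →₀ ℕ)
    (r : k) : weightPart w c N (p * monomial u r)
      = weightPart w (c + Finsupp.weight w u) N p * monomial u r := by
  ext m
  rw [coeff_weightPart, coeff_mul_monomial', coeff_mul_monomial', coeff_weightPart]
  by_cases h : u ≤ m
  · obtain ⟨v, rfl⟩ := exists_add_of_le h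
    simp only [h, if_true, map_add, add_tsub_cancel_left, ite_mul, zero_mul]
    congr 1
    exact propext (by constructor <;> intro h <;> omega)
  · simp [h]

/-- The polynomials all of whose monomials have weight less than `N`. -/
def weightLT (w : σ → ℕ) (N : ℕ) : Submodule k (MvPolynomial σ k) where
  carrier := {p | ∀ m, coeff m p ≠ 0 → Finsupp.weight w m < N}
  add_mem' {p q} hp hq m hm := by
    by_cases h : coeff m p = 0
    · exact hq m (by simpa [h] using hm)
    · exact hp m h
  zero_mem' := by simp
  smul_mem' c p hp m hm := hp m (by rintro h; simp [h] at hm)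

theorem mem_weightLT {w : σ → ℕ} {N : ℕ} {p : MvPolynomial σ k} :
    p ∈ weightLT w N ↔ ∀ m, coeff m p ≠ 0 → Finsupp.weight w m < N := Iff.rfl

theorem weightLT_mono {w : σ → ℕ} {M N : ℕ} (h : M ≤ N) :
    weightLT (k := k) w M ≤ weightLT w N :=
  fun _ hp m hm => (hp m hm).trans_le h

/-- The bounds are strict, so `M + 1` says weight at most `M`; no unit is lost in the product. -/
theorem mul_mem_weightLT {w : σ → ℕ} {M N : ℕ} {p q : MvPolynomial σ k}
    (hp : p ∈ weightLT w (M + 1)) (hq : q ∈ weightLT w N) : p * q ∈ weightLT w (M + N) := by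
  classical
  intro m hm
  obtain ⟨a, ha, b, hb, rfl⟩ := Finset.mem_add.mp (support_mul p q (mem_support_iff.mpr hm))
  have h1 := hp a (mem_support_iff.mp ha)
  have h2 := hq b (mem_support_iff.mp hb)
  rw [map_add]
  omega

theorem monomial_mem_weightLT {w : σ → ℕ} {N : ℕ} {u : σ →₀ ℕ} (r : k)
    (h : Finsupp.weight w u < N) : monomial u r ∈ weightLT w N := by
  classical
  intro m hm
  rw [coeff_monomial] at hm
  split_ifs at hm with h'
  · exact h' ▸ h
  · exact absurd rfl hm

theorem X_mem_weightLT {w : σ → ℕ} {N : ℕ} {x : σ} (h : w x < N) :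
    (X x : MvPolynomial σ k) ∈ weightLT w N :=
  monomial_mem_weightLT 1 (by simpa [Finsupp.weight_single] using h)

theorem C_mem_weightLT {w : σ → ℕ} {N : ℕ} (r : k) (h : 0 < N) :
    (C r : MvPolynomial σ k) ∈ weightLT w N :=
  monomial_mem_weightLT r (by simpa using h)

variable [CharZero k] [Fintype J]

/-- If the leading monomials of the `G j` are pairwise coprime, then every combination of the
`G j` becomes, after subtraction of a Koszul syzygy, a combination without cancellation of leading
terms. -/
theorem koszul_reduce (w : σ → ℕ) (u : J → σ →₀ ℕ)
    (hu : Pairwise fun i j => Disjoint (u i) (u j)) (G : J → MvPolynomial σ k)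
    (hG : ∀ j, G j - monomial (u j) 1 ∈ weightLT w (Finsupp.weight w (u j))) (N₀ : ℕ)
    (a : J → MvPolynomial σ k) (h : ∑ j, a j * G j ∈ weightLT w N₀) :
    ∃ T : J → J → MvPolynomial σ k, (∀ i j, T i j = -T j i) ∧
      ∀ j m, coeff m (a j - ∑ i, T j i * G i) ≠ 0 →
        Finsupp.weight w m + Finsupp.weight w (u j) < N₀ := by
  -- The induction is on the excess `n` of the weights of the terms `a j * G j` over the target
  -- `N₀`; any crude bound starts it.
  obtain ⟨n, hn⟩ : ∃ n, ∀ j m, coeff m (a j) ≠ 0 →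
      Finsupp.weight w m + Finsupp.weight w (u j) < N₀ + n := by
    refine ⟨1 + ∑ j, ∑ m ∈ (a j).support, (Finsupp.weight w m + Finsupp.weight w (u j)), ?_⟩
    intro j m hm
    have h1 := Finset.single_le_sum (f := fun m => Finsupp.weight w m + Finsupp.weight w (u j))
      (fun _ _ => Nat.zero_le _) (mem_support_iff.mpr hm)
    have h2 := Finset.single_le_sum
      (f := fun j => ∑ m ∈ (a j).support, (Finsupp.weight w m + Finsupp.weight w (u j)))
      (fun _ _ => Nat.zero_le _) (Finset.mem_univ j)
    beta_reduce at h1 h2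
    omega
  induction n generalizing a with
  | zero => exact ⟨0, by simp, by simpa using hn⟩
  | succ n ih =>
    set W : J → ℕ := fun j => Finsupp.weight w (u j) with hW
    -- The part of `a j * G j` of top weight `N₀ + n` comes only from `b j` times the leading
    -- monomial. The total sum lies below `N₀`, so these parts cancel and form a syzygy of
    -- monomials.
    set b : J → MvPolynomial σ k := fun j => weightPart w (W j) (N₀ + n) (a j) with hb
    have hlead : ∑ j, b j * monomial (u j) 1 = 0 := by
      have h1 : weightPart w 0 (N₀ + n) (∑ j, a j * G j) = 0 := by
        ext m
        rw [coeff_weightPart, coeff_zero]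
        split_ifs with hm
        · by_contra hne
          have := h m hne
          omega
        · rfl
      have h2 : ∀ j, weightPart w 0 (N₀ + n) (a j * G j) = b j * monomial (u j) 1 := by
        intro j
        have : a j * G j = a j * monomial (u j) 1 + a j * (G j - monomial (u j) 1) := by ring
        rw [this, map_add, weightPart_mul_monomial, zero_add, add_eq_left]
        ext m
        rw [coeff_weightPart, coeff_zero]
        split_ifs with hm
        · by_contra hne
          classical
          obtain ⟨x, hx, y, hy, rfl⟩ := Finset.mem_add.mp (support_mul _ _ (mem_support_iff.mpr hne))
          have h1 := hn j x (mem_support_iff.mp hx)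
          have h2 := hG j y (mem_support_iff.mp hy)
          rw [map_add] at hm
          omega
        · rfl
      rw [map_sum] at h1
      rw [← h1]
      exact Finset.sum_congr rfl fun j _ => (h2 j).symm
    obtain ⟨S, hS, hSb⟩ := koszul_monomial u hu Finset.univ b hlead
    -- Keeping only the homogeneous part of `S` still solves the equation for `b`, and it ensures
    -- that the lower terms of the `G i` contribute strictly below the top weight.
    set T : J → J → MvPolynomial σ k := fun i j => weightPart w (W i + W j) (N₀ + n) (S i j)
      with hTdef
    have hT : ∀ i j, T i j = -T j i := fun i j => by
      simp only [hTdef]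
      rw [hS i j, map_neg, add_comm]
    have hTb : ∀ i, b i = ∑ j, T i j * monomial (u j) 1 := by
      intro i
      have h1 : weightPart w (W i) (N₀ + n) (b i) = b i := by
        ext m
        simp only [hb, coeff_weightPart]
        split_ifs <;> rfl
      rw [← h1, hSb i (Finset.mem_univ i), map_sum]
      exact Finset.sum_congr rfl fun j _ => weightPart_mul_monomial _ _ _ _ _ _
    obtain ⟨T', hT', hfin⟩ := ih (fun j => a j - ∑ i, T j i * G i) (by
        have : ∑ j, (a j - ∑ i, T j i * G i) * G j
            = ∑ j, a j * G j - ∑ j, (∑ i, T j i * G i) * G j := by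
          rw [← Finset.sum_sub_distrib]
          exact Finset.sum_congr rfl fun j _ => sub_mul _ _ _
        rw [this, sum_sum_antisymm hT G Finset.univ, sub_zero]
        exact h) (by
        intro j m hm
        have hsplit : a j - ∑ i, T j i * G i
            = (a j - b j) - ∑ i, T j i * (G i - monomial (u i) 1) := by
          simp only [mul_sub, Finset.sum_sub_distrib]
          rw [← hTb j]; ring
        rw [hsplit, coeff_sub] at hm
        by_cases h1 : coeff m (a j - b j) = 0
        · rw [h1, zero_sub, neg_ne_zero, coeff_sum] at hm
          obtain ⟨i, -, hi⟩ := Finset.exists_ne_zero_of_sum_ne_zero hm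
          classical
          obtain ⟨x, hx, y, hy, rfl⟩ := Finset.mem_add.mp (support_mul _ _ (mem_support_iff.mpr hi))
          have h2 := hG i y (mem_support_iff.mp hy)
          have h3 := mem_support_iff.mp hx
          simp only [hTdef] at h3
          rw [coeff_weightPart] at h3
          have h4 : Finsupp.weight w x + (W j + W i) = N₀ + n := by
            by_contra hne
            exact h3 (if_neg hne)
          rw [map_add]
          simp only [hW] at h4 ⊢
          omega
        · rw [coeff_sub] at h1
          simp only [hb] at h1
          rw [coeff_weightPart] at h1
          split_ifs at h1 with h2
          · exact absurd (sub_self _) h1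
          · have := hn j m (by simpa using h1)
            simp only [hW] at h2
            omega)
    refine ⟨fun i j => T i j + T' i j, fun i j => ?_, fun j m hm => hfin j m ?_⟩
    · beta_reduce
      rw [hT i j, hT' i j]; ring
    · have : a j - ∑ i, T j i * G i - ∑ i, T' j i * G i
          = a j - ∑ i, (T j i + T' j i) * G i := by
        simp only [add_mul, Finset.sum_add_distrib]; ring
      rwa [this]

/-- The case `N₀ = 0` of `koszul_reduce`: no monomial has weight below zero, so nothing remains
after the reduction. The leading coefficients are first scaled to one. -/
theorem koszul_of_coprime_leading (w : σ → ℕ) (u : J → σ →₀ ℕ)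
    (hu : Pairwise fun i j => Disjoint (u i) (u j)) (G : J → MvPolynomial σ k) (c : J → k)
    (hc : ∀ j, c j ≠ 0)
    (hG : ∀ j, G j - monomial (u j) (c j) ∈ weightLT w (Finsupp.weight w (u j)))
    (a : J → MvPolynomial σ k) (h : ∑ j, a j * G j = 0) :
    ∃ T : J → J → MvPolynomial σ k, (∀ i j, T i j = -T j i) ∧ ∀ j, a j = ∑ i, T j i * G i := by
  obtain ⟨T, hT, hTa⟩ := koszul_reduce w u hu (fun j => (c j)⁻¹ • G j) (fun j => by
      have : (c j)⁻¹ • G j - monomial (u j) 1 = (c j)⁻¹ • (G j - monomial (u j) (c j)) := by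
        rw [smul_sub, smul_monomial, smul_eq_mul, inv_mul_cancel₀ (hc j)]
      rw [this]
      exact Submodule.smul_mem _ _ (hG j)) 0 (fun j => c j • a j) (by
      have : ∑ j, (c j • a j) * ((c j)⁻¹ • G j) = ∑ j, a j * G j := by
        refine Finset.sum_congr rfl fun j _ => ?_
        rw [smul_mul_smul_comm, mul_inv_cancel₀ (hc j), one_smul]
      rw [this, h]
      exact zero_mem _)
  refine ⟨fun i j => ((c i)⁻¹ * (c j)⁻¹) • T i j, fun i j => ?_, fun j => ?_⟩
  · beta_reduce
    rw [hT i j, smul_neg, mul_comm]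
  · have h0 : c j • a j = ∑ i, T j i * ((c i)⁻¹ • G i) := by
      rw [← sub_eq_zero]
      ext m
      by_contra hne
      exact absurd (hTa j m hne) (Nat.not_lt_zero _)
    have h1 : a j = (c j)⁻¹ • (c j • a j) := by
      rw [smul_smul, inv_mul_cancel₀ (hc j), one_smul]
    rw [h1, h0, Finset.smul_sum]
    refine Finset.sum_congr rfl fun i _ => ?_
    rw [mul_smul_comm, smul_smul, smul_mul_assoc]

end Koszul

/-! ### Conserved vectors in momentum space -/

section Momentum

/-- Polynomials in the momenta of countably many particles: `X (i, μ)` is the component `μ` of the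
momentum of the particle `i`. -/
abbrev MomPoly := MvPolynomial (ℕ × Fin 4) ℂ

/-- The diagonal of the Minkowski metric. -/
def etaDiag : Fin 4 → ℂ := ![1, -1, -1, -1]

/-- The total momentum of the first `n` particles. -/
def totalMom (n : ℕ) (μ : Fin 4) : MomPoly := ∑ i ∈ Finset.range n, X (i, μ)

/-- The mass shell polynomial of the particle `i`. -/
def shell (M : ℕ → ℂ) (i : ℕ) : MomPoly := ∑ μ, C (etaDiag μ) * X (i, μ) ^ 2 + C (M i)

/-- The mass shell ideal of the first `n` particles. -/
def shellIdeal (n : ℕ) (M : ℕ → ℂ) : Ideal MomPoly :=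
  Ideal.span (Set.range fun i : Fin n => shell M i)

theorem shell_mem {n : ℕ} (M : ℕ → ℂ) {i : ℕ} (hi : i < n) : shell M i ∈ shellIdeal n M :=
  Ideal.subset_span ⟨⟨i, hi⟩, rfl⟩

theorem mem_shellIdeal {n : ℕ} {M : ℕ → ℂ} {p : MomPoly} :
    p ∈ shellIdeal n M ↔ ∃ a : Fin n → MomPoly, ∑ i : Fin n, a i * shell M i = p :=
  Ideal.mem_span_range_iff_exists_fun

theorem disjoint_of_forall {σ : Type*} {u v : σ →₀ ℕ} (h : ∀ x, u x = 0 ∨ v x = 0) :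
    Disjoint u v := by
  rw [disjoint_iff]
  ext x
  rcases h x with h | h <;> simp [h, bot_eq_zero]

/-- If `P·v = c` is invertible on shell, contraction with `v` is a homotopy for the Koszul complex
of `P`: with `T^{μν} = c⁻¹ (v^ν t^μ - v^μ t^ν)`, the sum `P_ν T^{μν}` is `c⁻¹ ((P·v) t^μ - v^μ
(P·t))`. -/
theorem exists_trivial_of_unit {n : ℕ} {M : ℕ → ℂ} {t v : Fin 4 → MomPoly} {c : ℂ} (hc : c ≠ 0)
    (hv : ∑ ν, totalMom n ν * v ν - C c ∈ shellIdeal n M)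
    (ht : ∑ μ, totalMom n μ * t μ ∈ shellIdeal n M) :
    ∃ T : Fin 4 → Fin 4 → MomPoly, (∀ μ ν, T μ ν = -T ν μ) ∧
      ∀ μ, t μ - ∑ ν, totalMom n ν * T μ ν ∈ shellIdeal n M := by
  refine ⟨fun μ ν => C c⁻¹ * (v ν * t μ - v μ * t ν), fun μ ν => by ring, fun μ => ?_⟩
  have hcc : C c⁻¹ * C c = (1 : MomPoly) := by rw [← C_mul, inv_mul_cancel₀ hc, C_1]
  have h : t μ - ∑ ν, totalMom n ν * (C c⁻¹ * (v ν * t μ - v μ * t ν))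
      = -(C c⁻¹ * t μ) * (∑ ν, totalMom n ν * v ν - C c)
        + C c⁻¹ * v μ * ∑ ν, totalMom n ν * t ν := by
    simp only [Fin.sum_univ_four]
    linear_combination (-t μ) * hcc
  rw [h]
  exact add_mem (Ideal.mul_mem_left _ _ hv) (Ideal.mul_mem_left _ _ ht)

/-! ### One particle -/

section OneParticle

/-- On the mass shell `P·p_0 = p_0² = -M 0` is a nonzero constant. -/
theorem exists_trivial_one_massive {M : ℕ → ℂ} (hM : M 0 ≠ 0) {t : Fin 4 → MomPoly}
    (ht : ∑ μ, totalMom 1 μ * t μ ∈ shellIdeal 1 M) :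
    ∃ T : Fin 4 → Fin 4 → MomPoly, (∀ μ ν, T μ ν = -T ν μ) ∧
      ∀ μ, t μ - ∑ ν, totalMom 1 ν * T μ ν ∈ shellIdeal 1 M := by
  refine exists_trivial_of_unit (v := fun ν => C (etaDiag ν) * X (0, ν)) (neg_ne_zero.mpr hM) ?_ ht
  have : ∑ ν, totalMom 1 ν * (C (etaDiag ν) * X (0, ν)) - C (-M 0) = shell M 0 := by
    simp only [shell, totalMom, Finset.sum_range_one, C_neg, sub_neg_eq_add, add_left_inj]
    exact Finset.sum_congr rfl fun ν _ => by ring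
  rw [this]
  exact shell_mem M one_pos

/-- If `P·t = g p_0²`, then `t - p_0 g` (index raised) is a syzygy of the four variables `P_μ =
p_{0,μ}`, hence Koszul. The identity holds exactly, not only on shell. -/
theorem exists_form_one_massless {M : ℕ → ℂ} (hM : M 0 = 0) {t : Fin 4 → MomPoly}
    (ht : ∑ μ, totalMom 1 μ * t μ ∈ shellIdeal 1 M) :
    ∃ (g : MomPoly) (T : Fin 4 → Fin 4 → MomPoly), (∀ μ ν, T μ ν = -T ν μ) ∧
      ∀ μ, t μ = C (etaDiag μ) * X (0, μ) * g + ∑ ν, totalMom 1 ν * T μ ν := by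
  obtain ⟨a, ha⟩ := mem_shellIdeal.mp ht
  rw [Fin.sum_univ_one] at ha
  simp only [Fin.val_zero, shell, hM, C_0, add_zero] at ha
  obtain ⟨T, hT, hTa⟩ := koszul_of_coprime_leading (fun _ => 1)
    (fun μ : Fin 4 => Finsupp.single ((0 : ℕ), μ) 1)
    (fun i j hij => disjoint_of_forall fun x => by
      by_cases h : x = (0, i)
      · right; subst h; simp [Ne.symm hij]
      · left; simp [Ne.symm h])
    (fun μ => totalMom 1 μ) (fun _ => 1) (fun _ => one_ne_zero)
    (fun μ => by simp [totalMom, X])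
    (fun μ => t μ - C (etaDiag μ) * X (0, μ) * a 0) (by
      have : ∑ μ, (t μ - C (etaDiag μ) * X (0, μ) * a 0) * totalMom 1 μ
          = ∑ μ, totalMom 1 μ * t μ - a 0 * ∑ μ, C (etaDiag μ) * X (0, μ) ^ 2 := by
        rw [Finset.mul_sum, ← Finset.sum_sub_distrib]
        refine Finset.sum_congr rfl fun μ _ => ?_
        simp only [totalMom, Finset.sum_range_one]
        ring
      rw [this, ha, sub_self])
  refine ⟨a 0, T, hT, fun μ => ?_⟩
  have := hTa μ
  rw [sub_eq_iff_eq_add'] at this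
  rw [this]
  simp only [mul_comm]

/-- The weight which counts the momenta of the first particle. -/
def firstWeight (x : ℕ × Fin 4) : ℕ := if x.1 = 0 then 1 else 0

/-- The exact identity of `exists_form_one_massless` can be projected onto its part of degree `d +
1` in `p_0`; the factor `p_0` leaves degree `d` for `g`. -/
theorem homogeneous_form_one_massless {M : ℕ → ℂ} (hM : M 0 = 0) {t : Fin 4 → MomPoly}
    (ht : ∑ μ, totalMom 1 μ * t μ ∈ shellIdeal 1 M) (d : ℕ)
    (hd : ∀ μ m, coeff m (t μ) ≠ 0 → Finsupp.weight firstWeight m = d + 1) :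
    ∃ (g : MomPoly) (T : Fin 4 → Fin 4 → MomPoly), (∀ μ ν, T μ ν = -T ν μ) ∧
      (∀ m, coeff m g ≠ 0 → Finsupp.weight firstWeight m = d) ∧
      ∀ μ, t μ = C (etaDiag μ) * X (0, μ) * g + ∑ ν, totalMom 1 ν * T μ ν := by
  obtain ⟨g, T, hT, h⟩ := exists_form_one_massless hM ht
  refine ⟨weightPart firstWeight 1 (d + 1) g, fun μ ν => weightPart firstWeight 1 (d + 1) (T μ ν),
    fun μ ν => by beta_reduce; rw [hT μ ν, map_neg], fun m hm => ?_, fun μ => ?_⟩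
  · rw [coeff_weightPart] at hm
    split_ifs at hm with h'
    · omega
    · exact absurd rfl hm
  · have h1 : weightPart firstWeight 0 (d + 1) (t μ) = t μ := by
      ext m
      rw [coeff_weightPart]
      split_ifs with h'
      · rfl
      · by_contra hne
        exact h' (hd μ m (Ne.symm hne))
    have hX : ∀ (ν : Fin 4) (p : MomPoly), weightPart firstWeight 0 (d + 1) (X (0, ν) * p)
        = X (0, ν) * weightPart firstWeight 1 (d + 1) p := by
      intro ν p
      rw [mul_comm, X, weightPart_mul_monomial, mul_comm]
      simp [Finsupp.weight_single, firstWeight]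
    rw [← h1, h μ, map_add, map_sum, mul_assoc, C_mul', map_smul, hX, mul_assoc, C_mul']
    simp only [totalMom, Finset.sum_range_one, hX]

end OneParticle

/-! ### Two particles -/

section TwoParticles

/-- On the mass shell `P·(p_0 - p_1) = p_0² - p_1²` is the constant `M 1 - M 0`. -/
theorem exists_trivial_two {M : ℕ → ℂ} (hM : M 0 ≠ M 1) {t : Fin 4 → MomPoly}
    (ht : ∑ μ, totalMom 2 μ * t μ ∈ shellIdeal 2 M) :
    ∃ T : Fin 4 → Fin 4 → MomPoly, (∀ μ ν, T μ ν = -T ν μ) ∧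
      ∀ μ, t μ - ∑ ν, totalMom 2 ν * T μ ν ∈ shellIdeal 2 M := by
  refine exists_trivial_of_unit (v := fun ν => C (etaDiag ν) * (X (0, ν) - X (1, ν)))
    (sub_ne_zero.mpr hM.symm) ?_ ht
  have : ∑ ν, totalMom 2 ν * (C (etaDiag ν) * (X (0, ν) - X (1, ν))) - C (M 1 - M 0)
      = shell M 0 - shell M 1 := by
    simp only [shell, totalMom, Finset.sum_range_succ, Finset.sum_range_zero, C_sub,
      Fin.sum_univ_four]
    ring
  rw [this]
  exact sub_mem (shell_mem M two_pos) (shell_mem M one_lt_two)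

/-- For equal masses `shell M 1 = shell M 0 + P·(p_1 - p_0)`. Hence `t - (p_1 - p_0) b` together
with `-(a + b)` is a syzygy of the `P_μ` and `shell M 0`, which has to be Koszul. -/
theorem exists_form_two {M : ℕ → ℂ} (hM : M 0 = M 1) {t : Fin 4 → MomPoly} {a b : MomPoly}
    (ht : ∑ μ, totalMom 2 μ * t μ = a * shell M 0 + b * shell M 1) :
    ∃ T : Fin 4 → Fin 4 → MomPoly, (∀ μ ν, T μ ν = -T ν μ) ∧
      ∀ μ, t μ - C (etaDiag μ) * (X (1, μ) - X (0, μ)) * b - ∑ ν, totalMom 2 ν * T μ ν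
        ∈ shellIdeal 2 M := by
  -- With these weights `P_μ` has leading monomial `p_{1,μ}` and `shell M 0` has leading monomial
  -- `p_{0,0}²`. The index `none` stands for `shell M 0`.
  let w : ℕ × Fin 4 → ℕ := fun x => if x.1 = 0 then (if x.2 = 0 then 1 else 0) else 2
  obtain ⟨T, hT, hTa⟩ := koszul_of_coprime_leading (J := Option (Fin 4)) w
    (fun j => j.elim (Finsupp.single (0, 0) 2) fun μ => Finsupp.single (1, μ) 1)
    (by
      rintro (_ | i) (_ | j) hij
      · exact absurd rfl hij
      · refine disjoint_of_forall fun x => ?_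
        by_cases h : x = (0, 0)
        · right; subst h; simp
        · left; simp [Ne.symm h]
      · refine disjoint_of_forall fun x => ?_
        by_cases h : x = (0, 0)
        · left; subst h; simp
        · right; simp [Ne.symm h]
      · refine disjoint_of_forall fun x => ?_
        by_cases h : x = (1, i)
        · right; subst h
          have h' : j ≠ i := fun h => hij (congrArg some h.symm)
          simp [h']
        · left; simp [Ne.symm h])
    (fun j => j.elim (shell M 0) fun μ => totalMom 2 μ) (fun _ => 1) (fun _ => one_ne_zero)
    (by
      rintro (_ | μ)
      · have h : shell M 0 - monomial (Finsupp.single (0, 0) 2) 1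
            = -X (0, 1) * X (0, 1) - X (0, 2) * X (0, 2) - X (0, 3) * X (0, 3) + C (M 0) := by
          rw [← X_pow_eq_monomial]
          simp [shell, Fin.sum_univ_four, etaDiag]
          ring
        have hX : ∀ i : Fin 4, i ≠ 0 → (X (0, i) : MomPoly) ∈ weightLT w 1 := fun i hi =>
          X_mem_weightLT (by simp [w, hi])
        have hXX : ∀ i : Fin 4, i ≠ 0 → (X (0, i) * X (0, i) : MomPoly) ∈ weightLT w 2 :=
          fun i hi => weightLT_mono (by norm_num) (mul_mem_weightLT (M := 0) (hX i hi) (hX i hi))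
        simp only [Option.elim]
        rw [h, Finsupp.weight_single, neg_mul]
        exact add_mem (sub_mem (sub_mem (neg_mem (hXX 1 (by decide))) (hXX 2 (by decide)))
          (hXX 3 (by decide))) (C_mem_weightLT _ (by simp [w]))
      · have h : totalMom 2 μ - monomial (Finsupp.single (1, μ) 1) 1 = X (0, μ) := by
          simp [totalMom, Finset.sum_range_succ, X]
        simp only [Option.elim]
        rw [h, Finsupp.weight_single]
        refine X_mem_weightLT ?_
        by_cases h0 : μ = 0 <;> simp [w, h0])
    (fun j => j.elim (-(a + b)) fun μ => t μ - C (etaDiag μ) * (X (1, μ) - X (0, μ)) * b)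
    (by
      rw [Fintype.sum_option]
      simp only [Option.elim]
      have h : ∑ μ, (t μ - C (etaDiag μ) * (X (1, μ) - X (0, μ)) * b) * totalMom 2 μ
          = ∑ μ, totalMom 2 μ * t μ
            - b * ∑ μ, C (etaDiag μ) * (X (1, μ) - X (0, μ)) * totalMom 2 μ := by
        rw [Finset.mul_sum, ← Finset.sum_sub_distrib]
        exact Finset.sum_congr rfl fun μ _ => by ring
      rw [h, ht]
      simp only [shell, totalMom, Finset.sum_range_succ, Finset.sum_range_zero,
        Fin.sum_univ_four, hM]
      ring)
  refine ⟨fun μ ν => T (some μ) (some ν), fun μ ν => hT _ _, fun μ => ?_⟩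
  have h := hTa (some μ)
  rw [Fintype.sum_option] at h
  simp only [Option.elim] at h
  rw [h]
  simp only [mul_comm (totalMom 2 _)]
  rw [add_sub_cancel_right]
  exact Ideal.mul_mem_left _ _ (shell_mem M two_pos)

theorem weight_le_two_mul (w : ℕ × Fin 4 → ℕ) (hw : ∀ x, w x ≤ 2) (m : ℕ × Fin 4 →₀ ℕ) :
    Finsupp.weight w m ≤ 2 * Finsupp.weight (fun _ => 1) m := by
  simp only [Finsupp.weight_apply, Finsupp.sum, smul_eq_mul, mul_one, Finset.mul_sum]
  refine Finset.sum_le_sum fun x _ => ?_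
  rw [mul_comm]
  exact Nat.mul_le_mul_right _ (hw x)

/-- On low degree conserved vectors the mass shell polynomials appear with constant
coefficients. -/
theorem exists_const_coeff_two {M : ℕ → ℂ} {t : Fin 4 → MomPoly} (d : ℕ) (hd1 : d ≤ 1)
    (hd : ∀ μ m, coeff m (t μ) ≠ 0 → Finsupp.weight (fun _ => 1) m = d)
    (ht : ∑ μ, totalMom 2 μ * t μ ∈ shellIdeal 2 M) :
    ∃ (a : MomPoly) (c : ℂ), (d = 0 → c = 0) ∧
      ∑ μ, totalMom 2 μ * t μ = a * shell M 0 + C c * shell M 1 := by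
  -- In the ordinary degree the top part of a mass shell polynomial is not a monomial; doubling the
  -- weight of the time components singles out `p_{i,0}²`, of weight 4. All weights are positive, so
  -- that weight zero forces a constant.
  let w : ℕ × Fin 4 → ℕ := fun x => if x.2 = 0 then 2 else 1
  have hw : ∀ x, w x ≤ 2 := fun x => by simp only [w]; split_ifs <;> norm_num
  obtain ⟨e, he⟩ := mem_shellIdeal.mp ht
  obtain ⟨T, hT, hTa⟩ := koszul_reduce (J := Fin 2) w
    (fun i => Finsupp.single ((i : ℕ), 0) 2)
    (fun i j hij => disjoint_of_forall fun x => by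
      by_cases h : x = ((i : ℕ), 0)
      · right; subst h; simp [Fin.val_inj, Ne.symm hij]
      · left; simp [Ne.symm h])
    (fun i => shell M i)
    (fun i => by
      have h : shell M i - monomial (Finsupp.single ((i : ℕ), 0) 2) 1
          = (-(X ((i : ℕ), 1) * X ((i : ℕ), 1)) - X ((i : ℕ), 2) * X ((i : ℕ), 2)
            - X ((i : ℕ), 3) * X ((i : ℕ), 3) + C (M i) : MomPoly) := by
        rw [← X_pow_eq_monomial]
        simp [shell, Fin.sum_univ_four, etaDiag]
        ring
      have hX : ∀ j : Fin 4, j ≠ 0 → (X ((i : ℕ), j) : MomPoly) ∈ weightLT w 2 := fun j hj =>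
        X_mem_weightLT (by simp [w, hj])
      have hXX : ∀ j : Fin 4, j ≠ 0 → (X ((i : ℕ), j) * X ((i : ℕ), j) : MomPoly)
          ∈ weightLT w 4 :=
        fun j hj => weightLT_mono (by norm_num) (mul_mem_weightLT (M := 1) (hX j hj) (hX j hj))
      rw [h, Finsupp.weight_single]
      simp only [w, if_true]
      exact add_mem (sub_mem (sub_mem (neg_mem (hXX 1 (by decide))) (hXX 2 (by decide)))
        (hXX 3 (by decide))) (C_mem_weightLT _ (by norm_num)))
    -- The terms of `P·t` have weight at most `2 + 2 d`. After the reduction the coefficients of the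
    -- mass shell polynomials satisfy `weight + 4 < 2 d + 3`, so they vanish for `d = 0` and are
    -- constant for `d = 1`.
    (2 * d + 3) e (by
      rw [he]
      refine Submodule.sum_mem _ fun μ _ => ?_
      have h2 : t μ ∈ weightLT w (2 * d + 1) := mem_weightLT.mpr fun m hm => by
        have := weight_le_two_mul w hw m
        rw [hd μ m hm] at this
        omega
      have h1 : totalMom 2 μ ∈ weightLT w (2 + 1) :=
        Submodule.sum_mem _ fun i _ => X_mem_weightLT (k := ℂ) (Nat.lt_succ_of_le (hw _))
      exact weightLT_mono (by omega) (mul_mem_weightLT h1 h2))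
  set b : Fin 2 → MomPoly := fun j => e j - ∑ i, T j i * shell M i with hb
  have hsum : ∑ j, b j * shell M j = ∑ μ, totalMom 2 μ * t μ := by
    rw [← he, ← sub_zero (∑ j : Fin 2, e j * shell M j),
      ← sum_sum_antisymm hT (fun i : Fin 2 => shell M i) Finset.univ, ← Finset.sum_sub_distrib]
    exact Finset.sum_congr rfl fun j _ => sub_mul _ _ _
  have hbound : ∀ m, coeff m (b 1) ≠ 0 → m = 0 ∧ d ≠ 0 := by
    intro m hm
    have h := hTa 1 m hm
    rw [Finsupp.weight_single] at h
    simp only [w, if_true, smul_eq_mul] at h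
    refine ⟨?_, by omega⟩
    by_contra hne
    obtain ⟨x, hx⟩ := DFunLike.ne_iff.mp hne
    have h3 := Finsupp.le_weight_of_ne_zero' w hx
    have h4 : 1 ≤ w x := by simp only [w]; split_ifs <;> norm_num
    simp only [w] at h3 h4
    omega
  refine ⟨b 0, coeff 0 (b 1), fun h0 => ?_, ?_⟩
  · by_contra hne
    exact (hbound 0 hne).2 h0
  · have hC : b 1 = C (coeff 0 (b 1)) := by
      ext m
      rw [coeff_C]
      split_ifs with h
      · rw [← h]
      · by_contra hne
        exact h (hbound m hne).1.symm
    rw [← hC, ← hsum, Fin.sum_univ_two]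
    rfl

end TwoParticles

end Momentum

/-! ### Three or more particles -/

section ManyParticles

/-- The weights of the momenta which make the leading monomials of the total momentum and of the
mass shell polynomials coprime. -/
def momWeight : ℕ × Fin 4 → ℕ
  | (0, _) => 100
  | (1, μ) => ![10, 0, 9, 0] μ
  | (2, μ) => ![0, 10, 9, 0] μ
  | (_ + 3, μ) => ![1, 0, 0, 0] μ

/-- The leading monomials of the mass shell polynomials, except for the first particle. -/
def shellLead : ℕ → (ℕ × Fin 4 →₀ ℕ)
  | 0 => Finsupp.single (1, 0) 2
  | 1 => Finsupp.single (2, 1) 2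
  | i + 2 => Finsupp.single (i + 3, 0) 2

/-- The leading monomials of the total momentum (`some (inl μ)`), of the mass shell polynomials
(`some (inr i)`), and of the remainder of the mass shell polynomial of the first particle
(`none`). -/
def leadMon (k : ℕ) : Option (Fin 4 ⊕ Fin (k + 2)) → (ℕ × Fin 4 →₀ ℕ)
  | none => Finsupp.single (1, 2) 1 + Finsupp.single (2, 2) 1
  | some (Sum.inl μ) => Finsupp.single (0, μ) 1
  | some (Sum.inr i) => shellLead i

/-- The generator to which a component of a momentum belongs by its leading monomial. -/
def leadOwner : ℕ × Fin 4 → Option (Fin 4 ⊕ ℕ)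
  | (0, μ) => some (Sum.inl μ)
  | (1, μ) => if μ = 0 then some (Sum.inr 0) else none
  | (2, μ) => if μ = 1 then some (Sum.inr 1) else none
  | (i + 3, _) => some (Sum.inr (i + 2))

theorem leadOwner_eq {k : ℕ} {j : Option (Fin 4 ⊕ Fin (k + 2))} {x : ℕ × Fin 4}
    (h : leadMon k j x ≠ 0) : leadOwner x = j.map (Sum.map id Fin.val) := by
  have hs : ∀ {y : ℕ × Fin 4} {n : ℕ}, Finsupp.single y n x ≠ 0 → y = x := fun h => by
    by_contra hne
    exact h (by simp [hne])
  rcases j with _ | μ | ⟨i, hi⟩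
  · simp only [leadMon, Finsupp.coe_add, Pi.add_apply, ne_eq, Nat.add_eq_zero_iff, not_and_or] at h
    rcases h with h | h <;> rw [← hs h] <;> rfl
  · rw [← hs h]; rfl
  · rcases i with _ | _ | i <;> simp only [leadMon, shellLead] at h <;> rw [← hs h] <;> rfl

/-- A variable in a leading monomial determines the generator, namely by `leadOwner`. -/
theorem leadMon_disjoint (k : ℕ) : Pairwise fun i j => Disjoint (leadMon k i) (leadMon k j) := by
  intro i j hij
  refine disjoint_of_forall fun x => ?_
  by_contra! h
  refine hij (Option.map_injective (Sum.map_injective.mpr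
    ⟨Function.injective_id, Fin.val_injective⟩) ?_)
  rw [← leadOwner_eq h.1, ← leadOwner_eq h.2]

/-- The momentum of all particles but the first. -/
def restMom (k : ℕ) (μ : Fin 4) : MomPoly := ∑ i : Fin (k + 2), X ((i : ℕ) + 1, μ)

theorem totalMom_eq (k : ℕ) (μ : Fin 4) : totalMom (k + 3) μ = X (0, μ) + restMom k μ := by
  rw [totalMom, Finset.sum_range_succ', restMom, Finset.sum_range, add_comm]

/-- The coefficient of the total momentum in the mass shell polynomial of the first particle. -/
def shellCoeff (k : ℕ) (μ : Fin 4) : MomPoly :=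
  C (etaDiag μ) * (totalMom (k + 3) μ - 2 * restMom k μ)

/-- The remainder of the mass shell polynomial of the first particle modulo the total momentum and
the other mass shell polynomials. -/
def shellRest (k : ℕ) (M : ℕ → ℂ) : MomPoly :=
  shell M 0 - ∑ i : Fin (k + 2), shell M (i + 1) - ∑ μ, totalMom (k + 3) μ * shellCoeff k μ

/-- Modulo `P` the momentum `p_0` is minus that of the other particles. Its square then loses their
individual squares to the other mass shell polynomials, and only cross terms `p_i·p_j` remain. With
just one other particle there would be no cross term, which is why two particles are exceptional. -/
theorem shellRest_eq (k : ℕ) (M : ℕ → ℂ) :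
    shellRest k M = ∑ μ, C (etaDiag μ) * (restMom k μ ^ 2 - ∑ i : Fin (k + 2), X ((i : ℕ) + 1, μ) ^ 2)
      + C (M 0 - ∑ i : Fin (k + 2), M (i + 1)) := by
  simp only [shellRest, shell, shellCoeff, Finset.sum_add_distrib, mul_sub, Finset.sum_sub_distrib,
    Finset.mul_sum, C_sub, map_sum]
  rw [Finset.sum_comm (s := (Finset.univ : Finset (Fin (k + 2))))]
  have : ∀ μ, C (etaDiag μ) * X (0, μ) ^ 2 - (totalMom (k + 3) μ * (C (etaDiag μ) * totalMom (k + 3) μ)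
      - totalMom (k + 3) μ * (C (etaDiag μ) * (2 * restMom k μ)))
      = C (etaDiag μ) * restMom k μ ^ 2 := fun μ => by
    rw [totalMom_eq]; ring
  simp only [← this, Finset.sum_sub_distrib]
  ring

/-- The momentum of all particles but the first three. -/
def tailMom (k : ℕ) (μ : Fin 4) : MomPoly := ∑ i : Fin k, X ((i : ℕ) + 3, μ)

theorem shellRest_sub_lead (k : ℕ) (M : ℕ → ℂ) :
    shellRest k M - monomial (leadMon k none) (-2)
      = ∑ μ, C (etaDiag μ) * ((if μ = 2 then 0 else 2 * (X (1, μ) * X (2, μ)))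
          + 2 * (X (1, μ) * tailMom k μ) + 2 * (X (2, μ) * tailMom k μ)
          + tailMom k μ * tailMom k μ - ∑ i : Fin k, X ((i : ℕ) + 3, μ) * X ((i : ℕ) + 3, μ))
        + C (M 0 - ∑ i : Fin (k + 2), M (i + 1)) := by
  have hlead : (monomial (leadMon k none) (-2) : MomPoly) = -2 * (X (1, 2) * X (2, 2)) := by
    simp only [leadMon, X, monomial_mul, mul_one]
    rw [← mul_one (-2 : ℂ), ← C_mul_monomial, C_neg, map_ofNat]
  rw [shellRest_eq, hlead]
  simp only [restMom, Fin.sum_univ_succ (n := k + 1), Fin.sum_univ_succ (n := k), tailMom,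
    Fin.val_zero, Fin.val_succ, zero_add, add_assoc, Nat.reduceAdd]
  simp only [Fin.sum_univ_four, etaDiag, Matrix.cons_val]
  simp only [Fin.reduceEq, if_true, if_false, sq, C_neg, C_1]
  ring

theorem X_mem_of_tail {k : ℕ} (i : Fin k) (μ : Fin 4) :
    (X ((i : ℕ) + 3, μ) : MomPoly) ∈ weightLT momWeight 2 := by
  refine X_mem_weightLT ?_
  fin_cases μ <;> simp [momWeight]

/-- The cross term of particles 1 and 2 in direction 2 has weight `9 + 9 = 18`. In direction 0 only
the first factor is heavy, in direction 1 only the second, and in direction 3 neither, so the other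
cross terms of this pair have weight at most 10. Every term with a later particle has weight at most
11. -/
theorem shellRest_lead_mem (k : ℕ) (M : ℕ → ℂ) :
    shellRest k M - monomial (leadMon k none) (-2)
      ∈ weightLT momWeight (Finsupp.weight momWeight (leadMon k none)) := by
  have hw : Finsupp.weight momWeight (leadMon k none) = 18 := by
    simp [leadMon, Finsupp.weight_single, momWeight]
  have hC : ∀ (c : ℂ) {p : MomPoly}, p ∈ weightLT momWeight 18 →
      C c * p ∈ weightLT momWeight 18 := fun c p hp => by
    rw [C_mul']; exact Submodule.smul_mem _ _ hp
  have h2 : (2 : MomPoly) = C 2 := (map_ofNat C 2).symm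
  have h1 : ∀ μ, (X (1, μ) : MomPoly) ∈ weightLT momWeight 11 := fun μ =>
    X_mem_weightLT (by fin_cases μ <;> simp [momWeight])
  have h1' : ∀ μ, (X (2, μ) : MomPoly) ∈ weightLT momWeight 11 := fun μ =>
    X_mem_weightLT (by fin_cases μ <;> simp [momWeight])
  have hY : ∀ μ, tailMom k μ ∈ weightLT momWeight 2 := fun μ =>
    Submodule.sum_mem _ fun i _ => X_mem_of_tail i μ
  rw [hw, shellRest_sub_lead]
  refine add_mem (Submodule.sum_mem _ fun μ _ => hC _ ?_) (C_mem_weightLT _ (by norm_num))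
  rw [h2]
  refine sub_mem (add_mem (add_mem (add_mem ?_ (hC _ ?_)) (hC _ ?_)) ?_)
    (Submodule.sum_mem _ fun i _ => ?_)
  · split_ifs with h
    · exact zero_mem _
    · refine hC _ (weightLT_mono (by norm_num : 10 + 1 ≤ 18) ?_)
      by_cases h3 : μ = 1
      · subst h3
        rw [mul_comm]
        exact mul_mem_weightLT (M := 10) (h1' 1) (X_mem_weightLT (by simp [momWeight]))
      · refine mul_mem_weightLT (M := 10) (h1 μ) (X_mem_weightLT ?_)
        fin_cases μ <;> simp_all [momWeight]
  · exact weightLT_mono (by norm_num : 10 + 2 ≤ 18) (mul_mem_weightLT (M := 10) (h1 μ) (hY μ))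
  · exact weightLT_mono (by norm_num : 10 + 2 ≤ 18) (mul_mem_weightLT (M := 10) (h1' μ) (hY μ))
  · exact weightLT_mono (by norm_num : 1 + 2 ≤ 18) (mul_mem_weightLT (M := 1) (hY μ) (hY μ))
  · exact weightLT_mono (by norm_num : 1 + 2 ≤ 18)
      (mul_mem_weightLT (M := 1) (X_mem_of_tail i μ) (X_mem_of_tail i μ))

theorem totalMom_lead_mem (k : ℕ) (μ : Fin 4) :
    totalMom (k + 3) μ - monomial (leadMon k (some (Sum.inl μ))) 1
      ∈ weightLT momWeight (Finsupp.weight momWeight (leadMon k (some (Sum.inl μ)))) := by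
  have hw : Finsupp.weight momWeight (leadMon k (some (Sum.inl μ))) = 100 := by
    simp [leadMon, Finsupp.weight_single, momWeight]
  have hX : (monomial (leadMon k (some (Sum.inl μ))) 1 : MomPoly) = X (0, μ) := rfl
  rw [hw, hX, totalMom_eq, add_sub_cancel_left]
  refine Submodule.sum_mem _ fun i _ => X_mem_weightLT ?_
  obtain ⟨i, hi⟩ := i
  rcases i with _ | _ | i <;> fin_cases μ <;> simp [momWeight]

/-- For particles 1 and 2 the leading squares sit in the different directions 0 and 1 and have
weight 20, just above the weight 18 of the square in direction 2. Direction 1 is spacelike, whence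
the coefficient `-1` for particle 2. -/
theorem shell_lead_mem (k : ℕ) (M : ℕ → ℂ) (i : Fin (k + 2)) :
    shell M (i + 1) - monomial (leadMon k (some (Sum.inr i))) (if (i : ℕ) = 1 then -1 else 1)
      ∈ weightLT momWeight (Finsupp.weight momWeight (leadMon k (some (Sum.inr i)))) := by
  have hX : ∀ {x : ℕ × Fin 4} {N : ℕ} (N' : ℕ), momWeight x < N' + 1 → N' + (N' + 1) ≤ N →
      (C (-1) * X x ^ 2 : MomPoly) ∈ weightLT momWeight N := fun N' h h' => by
    rw [C_mul', sq]
    exact Submodule.smul_mem _ _ (weightLT_mono h'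
      (mul_mem_weightLT (X_mem_weightLT h) (X_mem_weightLT h)))
  have hX' : ∀ {x : ℕ × Fin 4} {N : ℕ} (N' : ℕ), momWeight x < N' + 1 → N' + (N' + 1) ≤ N →
      (X x ^ 2 : MomPoly) ∈ weightLT momWeight N := fun N' h h' => by
    rw [sq]
    exact weightLT_mono h' (mul_mem_weightLT (X_mem_weightLT h) (X_mem_weightLT h))
  obtain ⟨i, hi⟩ := i
  rcases i with _ | _ | i
  · have hw : Finsupp.weight momWeight (leadMon k (some (Sum.inr ⟨0, hi⟩))) = 20 := by
      simp [leadMon, shellLead, Finsupp.weight_single, momWeight]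
    have h : shell M (0 + 1) - monomial (leadMon k (some (Sum.inr ⟨0, hi⟩)))
        (if 0 = 1 then -1 else 1)
        = C (-1) * X (1, 1) ^ 2 + C (-1) * X (1, 2) ^ 2 + C (-1) * X (1, 3) ^ 2 + C (M 1) := by
      simp only [leadMon, shellLead, shell, Fin.sum_univ_four, etaDiag, Matrix.cons_val]
      rw [if_neg (by norm_num), ← X_pow_eq_monomial, C_1]
      ring
    rw [hw, h]
    exact add_mem (add_mem (add_mem (hX 9 (by simp [momWeight]) (by norm_num))
      (hX 9 (by simp [momWeight]) (by norm_num))) (hX 9 (by simp [momWeight]) (by norm_num)))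
      (C_mem_weightLT _ (by norm_num))
  · have hw : Finsupp.weight momWeight (leadMon k (some (Sum.inr ⟨0 + 1, hi⟩))) = 20 := by
      simp [leadMon, shellLead, Finsupp.weight_single, momWeight]
    have h : shell M (0 + 1 + 1) - monomial (leadMon k (some (Sum.inr ⟨0 + 1, hi⟩)))
        (if 0 + 1 = 1 then -1 else 1)
        = X (2, 0) ^ 2 + C (-1) * X (2, 2) ^ 2 + C (-1) * X (2, 3) ^ 2 + C (M 2) := by
      simp only [leadMon, shellLead, shell, Fin.sum_univ_four, etaDiag, Matrix.cons_val, zero_add,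
        if_true]
      rw [← mul_one (-1 : ℂ), ← C_mul_monomial, ← X_pow_eq_monomial, mul_one, C_1]
      ring
    rw [hw, h]
    exact add_mem (add_mem (add_mem (hX' 9 (by simp [momWeight]) (by norm_num))
      (hX 9 (by simp [momWeight]) (by norm_num))) (hX 9 (by simp [momWeight]) (by norm_num)))
      (C_mem_weightLT _ (by norm_num))
  · have hw : Finsupp.weight momWeight (leadMon k (some (Sum.inr ⟨i + 1 + 1, hi⟩))) = 2 := by
      simp [leadMon, shellLead, Finsupp.weight_single, momWeight]
    have h : shell M (i + 1 + 1 + 1) - monomial (leadMon k (some (Sum.inr ⟨i + 1 + 1, hi⟩)))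
        (if i + 1 + 1 = 1 then -1 else 1)
        = C (-1) * X (i + 3, 1) ^ 2 + C (-1) * X (i + 3, 2) ^ 2 + C (-1) * X (i + 3, 3) ^ 2
          + C (M (i + 3)) := by
      simp only [leadMon, shellLead, shell, Fin.sum_univ_four, etaDiag, Matrix.cons_val]
      rw [if_neg (by omega), ← X_pow_eq_monomial, C_1]
      ring
    rw [hw, h]
    exact add_mem (add_mem (add_mem (hX 0 (by simp [momWeight]) (by norm_num))
      (hX 0 (by simp [momWeight]) (by norm_num))) (hX 0 (by simp [momWeight]) (by norm_num)))
      (C_mem_weightLT _ (by norm_num))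

/-- Conserved vectors of at least three on-shell particles are trivial. -/
theorem exists_trivial_many (k : ℕ) (M : ℕ → ℂ) {t : Fin 4 → MomPoly}
    (ht : ∑ μ, totalMom (k + 3) μ * t μ ∈ shellIdeal (k + 3) M) :
    ∃ T : Fin 4 → Fin 4 → MomPoly, (∀ μ ν, T μ ν = -T ν μ) ∧
      ∀ μ, t μ - ∑ ν, totalMom (k + 3) ν * T μ ν ∈ shellIdeal (k + 3) M := by
  obtain ⟨a, ha⟩ := mem_shellIdeal.mp ht
  rw [Fin.sum_univ_succ] at ha
  simp only [Fin.val_zero, Fin.val_succ] at ha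
  let G : Option (Fin 4 ⊕ Fin (k + 2)) → MomPoly := fun j => j.elim (shellRest k M)
    (Sum.elim (totalMom (k + 3)) fun i => shell M (i + 1))
  let c : Option (Fin 4 ⊕ Fin (k + 2)) → ℂ := fun j => j.elim (-2)
    (Sum.elim (fun _ => 1) fun i => if (i : ℕ) = 1 then -1 else 1)
  have hsum : ∀ f : Option (Fin 4 ⊕ Fin (k + 2)) → MomPoly,
      ∑ j, f j = f none + (∑ μ, f (some (Sum.inl μ)) + ∑ i, f (some (Sum.inr i))) := fun f => by
    rw [Fintype.sum_option, Fintype.sum_sum_type]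
  obtain ⟨T, hT, hTa⟩ := koszul_of_coprime_leading momWeight (leadMon k) (leadMon_disjoint k) G c
    (by
      rintro (_ | μ | i)
      · simp [c]
      · simp [c]
      · simp only [c, Option.elim, Sum.elim_inr]
        split_ifs <;> simp)
    (by
      rintro (_ | μ | i)
      · exact shellRest_lead_mem k M
      · exact totalMom_lead_mem k μ
      · exact shell_lead_mem k M i)
    -- `shell M 0` is replaced by `shellRest`, the other mass shell polynomials and `P·shellCoeff`,
    -- and the coefficients are collected.
    (fun j => j.elim (-a 0) (Sum.elim (fun μ => t μ - a 0 * shellCoeff k μ)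
      fun i => -(a i.succ + a 0)))
    (by
      rw [hsum]
      simp only [G, Option.elim, Sum.elim_inl, Sum.elim_inr, shellRest, sub_mul, neg_mul, add_mul,
        Finset.sum_sub_distrib, Finset.sum_neg_distrib, Finset.sum_add_distrib, mul_sub,
        Finset.mul_sum]
      have h1 : ∑ μ, t μ * totalMom (k + 3) μ = ∑ μ, totalMom (k + 3) μ * t μ :=
        Finset.sum_congr rfl fun μ _ => mul_comm _ _
      have h2 : ∑ μ, a 0 * (totalMom (k + 3) μ * shellCoeff k μ)
          = ∑ μ, a 0 * shellCoeff k μ * totalMom (k + 3) μ :=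
        Finset.sum_congr rfl fun μ _ => by ring
      rw [h1, h2, ← ha]
      ring)
  have h00 : T none none = 0 := self_eq_neg.mp (hT none none)
  have ha0 := hTa none
  rw [hsum] at ha0
  simp only [G, Option.elim, Sum.elim_inl, Sum.elim_inr, h00, zero_mul, zero_add] at ha0
  -- On shell, `shellRest` equals `-P·shellCoeff`, and by `ha0` the coefficient `a 0` is the
  -- combination `∑ P_ν T(ν, none)`. Substituting both into the Koszul form of `t μ` gives the two
  -- correction terms, which are together antisymmetric.
  refine ⟨fun μ ν => T (some (Sum.inl μ)) (some (Sum.inl ν))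
      + shellCoeff k μ * T (some (Sum.inl ν)) none - T (some (Sum.inl μ)) none * shellCoeff k ν,
    fun μ ν => by beta_reduce; rw [hT (some (Sum.inl μ)) (some (Sum.inl ν))]; ring, fun μ => ?_⟩
  have hμ := hTa (some (Sum.inl μ))
  rw [hsum] at hμ
  simp only [G, Option.elim, Sum.elim_inl, Sum.elim_inr] at hμ
  have h1 : ∑ ν, T none (some (Sum.inl ν)) * totalMom (k + 3) ν
      = -∑ ν, totalMom (k + 3) ν * T (some (Sum.inl ν)) none := by
    rw [← Finset.sum_neg_distrib]
    exact Finset.sum_congr rfl fun ν _ => by rw [hT none]; ring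
  have h2 : ∑ ν, T (some (Sum.inl μ)) (some (Sum.inl ν)) * totalMom (k + 3) ν
      = ∑ ν, totalMom (k + 3) ν * T (some (Sum.inl μ)) (some (Sum.inl ν)) :=
    Finset.sum_congr rfl fun ν _ => mul_comm _ _
  have h3 : ∑ ν, totalMom (k + 3) ν * (T (some (Sum.inl μ)) (some (Sum.inl ν))
      + shellCoeff k μ * T (some (Sum.inl ν)) none - T (some (Sum.inl μ)) none * shellCoeff k ν)
      = ∑ ν, totalMom (k + 3) ν * T (some (Sum.inl μ)) (some (Sum.inl ν))
        + shellCoeff k μ * ∑ ν, totalMom (k + 3) ν * T (some (Sum.inl ν)) none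
        - T (some (Sum.inl μ)) none * ∑ ν, totalMom (k + 3) ν * shellCoeff k ν := by
    rw [Finset.mul_sum, Finset.mul_sum, ← Finset.sum_add_distrib, ← Finset.sum_sub_distrib]
    exact Finset.sum_congr rfl fun ν _ => by ring
  have key : t μ - ∑ ν, totalMom (k + 3) ν * (T (some (Sum.inl μ)) (some (Sum.inl ν))
      + shellCoeff k μ * T (some (Sum.inl ν)) none - T (some (Sum.inl μ)) none * shellCoeff k ν)
      = -shellCoeff k μ * ∑ i : Fin (k + 2), T none (some (Sum.inr i)) * shell M (i + 1)
        + ∑ i : Fin (k + 2), T (some (Sum.inl μ)) (some (Sum.inr i)) * shell M (i + 1)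
        + T (some (Sum.inl μ)) none * (shell M 0 - ∑ i : Fin (k + 2), shell M (i + 1)) := by
    rw [h3]
    rw [h1] at ha0
    rw [h2, shellRest] at hμ
    linear_combination hμ - shellCoeff k μ * ha0
  rw [key]
  have hmem : ∀ i : Fin (k + 2), shell M (i + 1) ∈ shellIdeal (k + 3) M := fun i =>
    shell_mem M (by omega)
  exact add_mem (add_mem (Ideal.mul_mem_left _ _ (Ideal.sum_mem _ fun i _ =>
      Ideal.mul_mem_left _ _ (hmem i)))
    (Ideal.sum_mem _ fun i _ => Ideal.mul_mem_left _ _ (hmem i)))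
    (Ideal.mul_mem_left _ _ (sub_mem (shell_mem M (by omega)) (Ideal.sum_mem _ fun i _ => hmem i)))

end ManyParticles

variable {F : Type*}

/-! ### Words, signed insertions and symmetrization -/

section Words

/-- Formal linear combinations of words in the jet coordinates. -/
abbrev WordSpace (F : Type*) := List (Jet F) →₀ ℂ

variable (odd : F → Bool) (m : F → ℝ≥0)

/-- The on-shell polynomial of a linear combination of words. -/
def wordEval : WordSpace F →ₗ[ℂ] OnShellPoly odd m := Finsupp.linearCombination ℂ (mono odd m)

/-- Prepending a word to all words. -/
def prefixMap (u : List (Jet F)) : WordSpace F →ₗ[ℂ] WordSpace F :=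
  Finsupp.lmapDomain ℂ ℂ (u ++ ·)

/-- Prepending a letter to all words. -/
def consMap (A : Jet F) : WordSpace F →ₗ[ℂ] WordSpace F := prefixMap [A]

/-- The signed sum over all insertions of a letter into a word. -/
def insWord (A : Jet F) : List (Jet F) → WordSpace F
  | [] => Finsupp.single [A] 1
  | B :: w => Finsupp.single (A :: B :: w) 1 + fieldSign odd A.1 B.1 • consMap B (insWord A w)

/-- The signed sum over all insertions of a letter. -/
def ins (A : Jet F) : WordSpace F →ₗ[ℂ] WordSpace F := Finsupp.linearCombination ℂ (insWord odd A)

@[simp] theorem wordEval_single (w : List (Jet F)) :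
    wordEval odd m (Finsupp.single w 1) = mono odd m w := by
  simp [wordEval]

@[simp] theorem prefixMap_single (u w : List (Jet F)) :
    prefixMap u (Finsupp.single w 1) = Finsupp.single (u ++ w) 1 := by
  simp [prefixMap]

@[simp] theorem consMap_single (A : Jet F) (w : List (Jet F)) :
    consMap A (Finsupp.single w 1) = Finsupp.single (A :: w) 1 :=
  prefixMap_single _ _

@[simp] theorem ins_single (A : Jet F) (w : List (Jet F)) :
    ins odd A (Finsupp.single w 1) = insWord odd A w := by
  simp [ins]

variable {odd m}

theorem word_ext {V : Type*} [AddCommMonoid V] [Module ℂ V] {f g : WordSpace F →ₗ[ℂ] V}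
    (h : ∀ w, f (Finsupp.single w 1) = g (Finsupp.single w 1)) (x : WordSpace F) : f x = g x :=
  DFunLike.congr_fun (Finsupp.lhom_ext' fun w => LinearMap.ext_ring (h w)) x

theorem prefixMap_cons (A : Jet F) (u : List (Jet F)) (x : WordSpace F) :
    prefixMap (A :: u) x = consMap A (prefixMap u x) :=
  word_ext (f := prefixMap (A :: u)) (g := (consMap A).comp (prefixMap u)) (fun w => by simp) x

theorem ins_cons (A B : Jet F) (x : WordSpace F) :
    ins odd A (consMap B x)
      = consMap A (consMap B x) + fieldSign odd A.1 B.1 • consMap B (ins odd A x) :=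
  word_ext (f := (ins odd A).comp (consMap B))
    (g := (consMap A).comp (consMap B) + fieldSign odd A.1 B.1 • (consMap B).comp (ins odd A))
    (fun w => by simp [insWord]) x

theorem fieldSign_comm (α β : F) : fieldSign odd α β = fieldSign odd β α := by
  simp only [fieldSign, Bool.and_comm]

theorem fieldSign_mul_self (α β : F) : fieldSign odd α β * fieldSign odd α β = 1 := by
  unfold fieldSign
  split_ifs <;> norm_num

/-- Both sides sum over all ways to place the two letters; exchanging the letters costs exactly
their sign. This makes insertion respect graded commutativity on the nose, unlike prepending. -/
theorem ins_comm (A B : Jet F) (x : WordSpace F) :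
    ins odd A (ins odd B x) = fieldSign odd A.1 B.1 • ins odd B (ins odd A x) := by
  refine word_ext (f := (ins odd A).comp (ins odd B))
    (g := fieldSign odd A.1 B.1 • (ins odd B).comp (ins odd A)) (fun w => ?_) x
  have hs := fieldSign_mul_self (odd := odd) A.1 B.1
  simp only [LinearMap.comp_apply, LinearMap.smul_apply]
  induction w with
  | nil =>
    rw [ins_single, ins_single, insWord, insWord, ← consMap_single, ← consMap_single, ins_cons,
      ins_cons, ins_single, ins_single, insWord, insWord, smul_add, smul_smul,
      fieldSign_comm B.1 A.1, hs, one_smul, add_comm]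
    simp
  | cons C w ih =>
    have h : ∀ D : Jet F, ins odd D (Finsupp.single (C :: w) 1)
        = consMap D (consMap C (Finsupp.single w 1))
          + fieldSign odd D.1 C.1 • consMap C (ins odd D (Finsupp.single w 1)) := fun D => by
      rw [← consMap_single, ins_cons]
    rw [h A, h B]
    simp only [map_add, map_smul, ins_cons, smul_add, smul_smul, ih]
    rw [fieldSign_comm B.1 A.1]
    have h1 : fieldSign odd A.1 B.1 * (fieldSign odd A.1 C.1 * fieldSign odd B.1 C.1)
        = fieldSign odd B.1 C.1 * fieldSign odd A.1 C.1 * fieldSign odd A.1 B.1 := by ring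
    simp only [← mul_assoc, hs, one_smul, one_mul]
    rw [mul_comm (fieldSign odd B.1 C.1 * fieldSign odd A.1 C.1), ← mul_assoc,
      mul_right_comm]
    module

variable (m) in
/-- Prepending the Klein-Gordon expression of a letter to all words. -/
def kgCons (B : Jet F) : WordSpace F →ₗ[ℂ] WordSpace F :=
  ∑ μ, ∑ ν, eta μ ν • consMap ((B.diff ν).diff μ) + (((m B.1 : ℝ) : ℂ) ^ 2) • consMap B

variable (m) in
/-- The span of the words one letter of which is replaced by its Klein-Gordon expression. -/
def kgSpan : Submodule ℂ (WordSpace F) :=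
  Submodule.span ℂ (Set.range fun p : List (Jet F) × Jet F × List (Jet F) =>
    prefixMap p.1 (kgCons m p.2.1 (Finsupp.single p.2.2 1)))

theorem prefixMap_kgCons_mem (u : List (Jet F)) (B : Jet F) (x : WordSpace F) :
    prefixMap u (kgCons m B x) ∈ kgSpan m := by
  induction x using Finsupp.induction_linear with
  | zero => simp
  | add x y hx hy => rw [map_add, map_add]; exact add_mem hx hy
  | single w c =>
    rw [← mul_one c, ← smul_eq_mul, ← Finsupp.smul_single, map_smul, map_smul]
    exact Submodule.smul_mem _ _ (Submodule.subset_span ⟨(u, B, w), rfl⟩)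

theorem kgCons_mem (B : Jet F) (x : WordSpace F) : kgCons m B x ∈ kgSpan m := by
  have h : prefixMap [] (kgCons m B x) = kgCons m B x :=
    word_ext (f := prefixMap []) (g := LinearMap.id) (fun w => by simp) _
  exact h ▸ prefixMap_kgCons_mem [] B x

theorem consMap_mem (A : Jet F) {x : WordSpace F} (hx : x ∈ kgSpan m) :
    consMap A x ∈ kgSpan m := by
  refine (Submodule.span_le (p := (kgSpan m).comap (consMap A))).mpr ?_ hx
  rintro _ ⟨⟨u, B, v⟩, rfl⟩
  simp only [Submodule.comap_coe, Set.mem_preimage, ← prefixMap_cons]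
  exact prefixMap_kgCons_mem _ _ _

/-- Differentiation does not change the parity of a field, so all terms of the Klein-Gordon
expression are passed with the same sign. -/
theorem ins_kgCons (A B : Jet F) (x : WordSpace F) :
    ins odd A (kgCons m B x)
      = consMap A (kgCons m B x) + fieldSign odd A.1 B.1 • kgCons m B (ins odd A x) := by
  simp only [kgCons, LinearMap.add_apply, LinearMap.sum_apply, LinearMap.smul_apply, map_add,
    map_sum, map_smul, ins_cons, Jet.diff, smul_add, Finset.sum_add_distrib, Finset.smul_sum]
  simp only [smul_comm (fieldSign odd A.1 B.1)]
  abel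

theorem ins_mem (A : Jet F) {x : WordSpace F} (hx : x ∈ kgSpan m) :
    ins odd A x ∈ kgSpan m := by
  refine (Submodule.span_le (p := (kgSpan m).comap (ins odd A))).mpr ?_ hx
  rintro _ ⟨⟨u, B, v⟩, rfl⟩
  simp only [Submodule.comap_coe, Set.mem_preimage, SetLike.mem_coe]
  induction u with
  | nil =>
    have h : prefixMap [] (kgCons m B (Finsupp.single v 1)) = kgCons m B (Finsupp.single v 1) :=
      word_ext (f := prefixMap []) (g := LinearMap.id) (fun w => by simp) _
    rw [h, ins_kgCons]
    exact add_mem (consMap_mem A (kgCons_mem _ _)) (Submodule.smul_mem _ _ (kgCons_mem _ _))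
  | cons C u ih =>
    rw [prefixMap_cons, ins_cons]
    refine add_mem (consMap_mem A (consMap_mem C (prefixMap_kgCons_mem _ _ _)))
      (Submodule.smul_mem _ _ (consMap_mem C ih))

/-- Inserting the Klein-Gordon expression puts it, up to sign, at each position of the word, and
every such term is a generator of the span. Together with `ins_comm` this makes insertion a
representation of the on-shell algebra. -/
theorem ins_klein_gordon_mem (B : Jet F) (x : WordSpace F) :
    ∑ μ, ∑ ν, eta μ ν • ins odd ((B.diff ν).diff μ) x + (((m B.1 : ℝ) : ℂ) ^ 2) • ins odd B x
      ∈ kgSpan m := by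
  induction x using Finsupp.induction_linear with
  | zero => simp
  | add x y hx hy =>
    simp only [map_add, smul_add, Finset.sum_add_distrib]
    convert add_mem hx hy using 1
    abel
  | single w c =>
    rw [← mul_one c, ← smul_eq_mul, ← Finsupp.smul_single]
    simp only [map_smul, smul_comm _ c]
    simp only [← Finset.smul_sum, ← smul_add]
    refine Submodule.smul_mem _ _ ?_
    induction w with
    | nil =>
      have h := kgCons_mem (m := m) B (Finsupp.single [] 1)
      simpa [kgCons, insWord] using h
    | cons C w ih =>
      have h := add_mem (kgCons_mem (m := m) B (consMap C (Finsupp.single w 1)))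
        (Submodule.smul_mem _ (fieldSign odd B.1 C.1) (consMap_mem C ih))
      have hC : (Finsupp.single (C :: w) 1 : WordSpace F) = consMap C (Finsupp.single w 1) := by
        simp
      rw [hC]
      simp only [ins_cons, kgCons, LinearMap.add_apply, LinearMap.sum_apply, LinearMap.smul_apply,
        map_add, map_sum, map_smul, smul_add, Finset.sum_add_distrib, Finset.smul_sum, Jet.diff,
        smul_comm (fieldSign odd B.1 C.1)] at h ⊢
      convert h using 1
      abel

/-- The action of the jet coordinate `A` on words modulo the Klein-Gordon equation. -/
def insQuot (odd : F → Bool) (m : F → ℝ≥0) (A : Jet F) :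
    Module.End ℂ (WordSpace F ⧸ kgSpan m) :=
  (kgSpan m).mapQ (kgSpan m) (ins odd A) fun _ hx => ins_mem A hx

theorem insQuot_mk (A : Jet F) (x : WordSpace F) :
    insQuot odd m A (Submodule.Quotient.mk x) = Submodule.Quotient.mk (ins odd A x) := rfl

/-- The representation of the on-shell polynomials by signed insertions. -/
def insRep (odd : F → Bool) (m : F → ℝ≥0) :
    OnShellPoly odd m →ₐ[ℂ] Module.End ℂ (WordSpace F ⧸ kgSpan m) :=
  lift odd m (FreeAlgebra.lift ℂ (insQuot odd m)) (by
    intro a b h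
    refine LinearMap.ext fun q => ?_
    obtain ⟨x, rfl⟩ := Submodule.Quotient.mk_surjective _ q
    cases h with
    | graded_comm A B =>
      simp only [map_mul, map_smul, FreeAlgebra.lift_ι_apply, Module.End.mul_apply,
        LinearMap.smul_apply, insQuot_mk]
      rw [ins_comm]
      rfl
    | klein_gordon A =>
      simp only [map_sum, map_smul, FreeAlgebra.lift_ι_apply, LinearMap.sum_apply,
        LinearMap.smul_apply, insQuot_mk]
      rw [neg_smul, ← sub_eq_zero, sub_neg_eq_add]
      have h := (Submodule.Quotient.mk_eq_zero _).mpr (ins_klein_gordon_mem (odd := odd) (m := m) A x)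
      simpa only [← Submodule.mkQ_apply, map_add, map_sum, map_smul] using h)

theorem insRep_y (A : Jet F) : insRep odd m (y odd m A) = insQuot odd m A := by
  simp [insRep, y, lift_mk]

variable (odd) in
/-- The signed sum over all permutations of a word. -/
def symWord : List (Jet F) → WordSpace F
  | [] => Finsupp.single [] 1
  | A :: w => ins odd A (symWord w)

variable (odd) in
/-- Signed symmetrization. -/
def sym : WordSpace F →ₗ[ℂ] WordSpace F := Finsupp.linearCombination ℂ (symWord odd)

@[simp] theorem sym_single (w : List (Jet F)) :
    sym odd (Finsupp.single w 1) = symWord odd w := by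
  simp [sym]

theorem sym_cons (A : Jet F) (x : WordSpace F) : sym odd (consMap A x) = ins odd A (sym odd x) :=
  word_ext (f := (sym odd).comp (consMap A)) (g := (ins odd A).comp (sym odd))
    (fun w => by simp [symWord]) x

theorem insRep_wordEval (x : WordSpace F) :
    insRep odd m (wordEval odd m x) (Submodule.Quotient.mk (Finsupp.single [] 1))
      = Submodule.Quotient.mk (sym odd x) := by
  refine word_ext (f := (LinearMap.applyₗ (Submodule.Quotient.mk (Finsupp.single [] 1))).comp
    ((insRep odd m).toLinearMap.comp (wordEval odd m)))
    (g := (kgSpan m).mkQ.comp (sym odd)) (fun w => ?_) x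
  simp only [LinearMap.comp_apply, wordEval_single, sym_single, LinearMap.applyₗ_apply_apply,
    AlgHom.toLinearMap_apply, Submodule.mkQ_apply]
  induction w with
  | nil => simp [mono, symWord]
  | cons A w ih =>
    rw [symWord, ← insQuot_mk, ← ih, ← insRep_y, ← Module.End.mul_apply, ← map_mul]
    rfl

/-- The key to detecting zero in the quotient algebra: a vanishing element acts as zero on the empty
word, where the action produces the symmetrization. -/
theorem sym_mem_of_wordEval_eq_zero {x : WordSpace F} (hx : wordEval odd m x = 0) :
    sym odd x ∈ kgSpan m := by
  rw [← Submodule.Quotient.mk_eq_zero, ← insRep_wordEval, hx, map_zero]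
  rfl

theorem mono_cons (A : Jet F) (w : List (Jet F)) :
    mono odd m (A :: w) = y odd m A * mono odd m w := by
  simp [mono]

theorem mono_append (u v : List (Jet F)) :
    mono odd m (u ++ v) = mono odd m u * mono odd m v := by
  simp [mono]

theorem wordEval_cons (A : Jet F) (x : WordSpace F) :
    wordEval odd m (consMap A x) = y odd m A * wordEval odd m x :=
  word_ext (f := (wordEval odd m).comp (consMap A))
    (g := (LinearMap.mulLeft ℂ (y odd m A)).comp (wordEval odd m))
    (fun w => by simp [mono_cons]) x

/-- The sign of each insertion is the one needed to move the letter back to the front, so all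
`w.length + 1` terms evaluate to the same monomial. -/
theorem wordEval_insWord (A : Jet F) (w : List (Jet F)) :
    wordEval odd m (insWord odd A w) = (w.length + 1 : ℂ) • mono odd m (A :: w) := by
  induction w with
  | nil => simp [insWord]
  | cons B w ih =>
    rw [insWord, map_add, map_smul, wordEval_cons, ih, wordEval_single, mono_cons A w,
      mul_smul_comm, ← mul_assoc, smul_comm, ← smul_mul_assoc, fieldSign_comm]
    have h := y_mul_y odd m A B
    rw [fieldSign_comm] at h
    rw [← h, mono_cons A, mono_cons B, List.length_cons, ← mul_assoc]
    push_cast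
    module

/-- The words with `n` letters and canonical dimension `e`. -/
def wordsOf (F : Type*) (n e : ℕ) : Set (List (Jet F)) := {w | w.length = n ∧ canonicalDim w = e}

theorem supported_induction {V : Type*} [AddCommMonoid V] [Module ℂ V] {s : Set (List (Jet F))}
    (f : WordSpace F →ₗ[ℂ] V) (p : Submodule ℂ V)
    (h : ∀ w ∈ s, f (Finsupp.single w 1) ∈ p) {x : WordSpace F}
    (hx : x ∈ Finsupp.supported ℂ ℂ s) : f x ∈ p := by
  rw [Finsupp.supported_eq_span_single] at hx
  refine (Submodule.span_le (p := p.comap f)).mpr ?_ hx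
  rintro _ ⟨w, hw, rfl⟩
  exact h w hw

theorem supported_eqOn {V : Type*} [AddCommGroup V] [Module ℂ V] {s : Set (List (Jet F))}
    {f g : WordSpace F →ₗ[ℂ] V} (h : ∀ w ∈ s, f (Finsupp.single w 1) = g (Finsupp.single w 1))
    {x : WordSpace F} (hx : x ∈ Finsupp.supported ℂ ℂ s) : f x = g x := by
  have := supported_induction (f - g) ⊥ (fun w hw => by simp [h w hw]) hx
  simpa [sub_eq_zero] using this

theorem canonicalDim_cons (A : Jet F) (w : List (Jet F)) :
    canonicalDim (A :: w) = 1 + Multiset.card A.2 + canonicalDim w := by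
  simp [canonicalDim]

theorem consMap_supported (A : Jet F) {n e : ℕ} {x : WordSpace F}
    (hx : x ∈ Finsupp.supported ℂ ℂ (wordsOf F n e)) :
    consMap A x ∈ Finsupp.supported ℂ ℂ (wordsOf F (n + 1) (1 + Multiset.card A.2 + e)) := by
  refine supported_induction _ _ (fun w hw => ?_) hx
  rw [consMap_single]
  exact Finsupp.single_mem_supported _ _ ⟨by simp [hw.1], by rw [canonicalDim_cons, hw.2]⟩

theorem insWord_supported (A : Jet F) (w : List (Jet F)) :
    insWord odd A w ∈ Finsupp.supported ℂ ℂ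
      (wordsOf F (w.length + 1) (1 + Multiset.card A.2 + canonicalDim w)) := by
  induction w with
  | nil => exact Finsupp.single_mem_supported _ _ ⟨rfl, by simp [canonicalDim]⟩
  | cons B w ih =>
    refine add_mem (Finsupp.single_mem_supported _ _ ⟨rfl, by simp only [canonicalDim_cons]⟩)
      (Submodule.smul_mem _ _ ?_)
    have h := consMap_supported B ih
    rwa [add_left_comm, ← canonicalDim_cons] at h

theorem ins_supported (A : Jet F) {n e : ℕ} {x : WordSpace F}
    (hx : x ∈ Finsupp.supported ℂ ℂ (wordsOf F n e)) :
    ins odd A x ∈ Finsupp.supported ℂ ℂ (wordsOf F (n + 1) (1 + Multiset.card A.2 + e)) := by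
  refine supported_induction _ _ (fun w hw => ?_) hx
  rw [ins_single]
  have h := insWord_supported (odd := odd) A w
  rwa [hw.1, hw.2] at h

theorem symWord_supported (w : List (Jet F)) :
    symWord odd w ∈ Finsupp.supported ℂ ℂ (wordsOf F w.length (canonicalDim w)) := by
  induction w with
  | nil => exact Finsupp.single_mem_supported _ _ ⟨rfl, rfl⟩
  | cons A w ih =>
    rw [symWord, canonicalDim_cons]
    exact ins_supported A ih

theorem wordEval_symWord (w : List (Jet F)) :
    wordEval odd m (symWord odd w) = (w.length.factorial : ℂ) • mono odd m w := by
  induction w with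
  | nil => simp [symWord]
  | cons A w ih =>
    have h := supported_eqOn (f := (wordEval odd m).comp (ins odd A))
      (g := (w.length + 1 : ℂ) • (wordEval odd m).comp (consMap A)) (fun v hv => by
        simp [wordEval_insWord, hv.1]) (symWord_supported (odd := odd) w)
    simp only [LinearMap.comp_apply, LinearMap.smul_apply] at h
    rw [symWord, h, wordEval_cons, ih, mono_cons, List.length_cons, Nat.factorial_succ,
      mul_smul_comm, smul_smul]
    push_cast
    rfl

variable (F) in
/-- Division of every word of length `n` by `n!`. -/
def divFactorial : WordSpace F →ₗ[ℂ] WordSpace F :=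
  Finsupp.linearCombination ℂ fun w => Finsupp.single w ((w.length.factorial : ℂ)⁻¹)

theorem divFactorial_single (w : List (Jet F)) :
    divFactorial F (Finsupp.single w 1) = (w.length.factorial : ℂ)⁻¹ • Finsupp.single w 1 := by
  simp [divFactorial]

/-- Averaging over signed permutations does not change the on-shell polynomial, so every element has
a graded symmetric representative. -/
theorem wordEval_divFactorial_sym (x : WordSpace F) :
    wordEval odd m (divFactorial F (sym odd x)) = wordEval odd m x := by
  refine word_ext (f := (wordEval odd m).comp ((divFactorial F).comp (sym odd)))
    (g := wordEval odd m) (fun w => ?_) x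
  have h := supported_eqOn (f := divFactorial F) (g := (w.length.factorial : ℂ)⁻¹ • LinearMap.id)
    (fun v hv => by rw [divFactorial_single, hv.1]; rfl) (symWord_supported (odd := odd) w)
  simp only [LinearMap.comp_apply, sym_single, LinearMap.smul_apply, LinearMap.id_apply,
    wordEval_single] at h ⊢
  rw [h, map_smul, wordEval_symWord, smul_smul, inv_mul_cancel₀, one_smul]
  exact_mod_cast Nat.factorial_ne_zero _

theorem divFactorial_sym_supported {s : Set (List (Jet F))} {x : WordSpace F}
    (hx : x ∈ Finsupp.supported ℂ ℂ s) :
    divFactorial F (sym odd x) ∈ Finsupp.supported ℂ ℂ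
      {v | ∃ w ∈ s, v.length = w.length ∧ canonicalDim v = canonicalDim w} := by
  refine supported_induction ((divFactorial F).comp (sym odd)) _ (fun w hw => ?_) hx
  rw [LinearMap.comp_apply, sym_single]
  refine supported_induction _ _ (fun v hv => ?_) (symWord_supported (odd := odd) w)
  rw [divFactorial_single]
  exact Submodule.smul_mem _ _ (Finsupp.single_mem_supported _ _ ⟨w, hw, hv⟩)

/-- The formal derivative of a word. -/
def derivWord (μ : Fin 4) : List (Jet F) → WordSpace F
  | [] => 0
  | A :: w => Finsupp.single (A.diff μ :: w) 1 + consMap A (derivWord μ w)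

variable (F) in
/-- The formal derivative on words. -/
def deriv (μ : Fin 4) : WordSpace F →ₗ[ℂ] WordSpace F :=
  Finsupp.linearCombination ℂ (derivWord μ)

@[simp] theorem deriv_single (μ : Fin 4) (w : List (Jet F)) :
    deriv F μ (Finsupp.single w 1) = derivWord μ w := by
  simp [deriv]

theorem deriv_cons (μ : Fin 4) (A : Jet F) (x : WordSpace F) :
    deriv F μ (consMap A x) = consMap (A.diff μ) x + consMap A (deriv F μ x) :=
  word_ext (f := (deriv F μ).comp (consMap A))
    (g := consMap (A.diff μ) + (consMap A).comp (deriv F μ)) (fun w => by simp [derivWord]) x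

theorem deriv_ins (μ : Fin 4) (A : Jet F) (x : WordSpace F) :
    deriv F μ (ins odd A x) = ins odd (A.diff μ) x + ins odd A (deriv F μ x) := by
  refine word_ext (f := (deriv F μ).comp (ins odd A))
    (g := ins odd (A.diff μ) + (ins odd A).comp (deriv F μ)) (fun w => ?_) x
  simp only [LinearMap.comp_apply, LinearMap.add_apply]
  induction w with
  | nil => simp [insWord, derivWord]
  | cons B w ih =>
    have hB : (Finsupp.single (B :: w) 1 : WordSpace F) = consMap B (Finsupp.single w 1) := by simp
    rw [hB]
    simp only [ins_cons, deriv_cons, map_add, map_smul, ih, smul_add, Jet.diff]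
    abel

theorem deriv_sym (μ : Fin 4) (x : WordSpace F) :
    deriv F μ (sym odd x) = sym odd (deriv F μ x) := by
  refine word_ext (f := (deriv F μ).comp (sym odd)) (g := (sym odd).comp (deriv F μ))
    (fun w => ?_) x
  simp only [LinearMap.comp_apply, sym_single, deriv_single]
  induction w with
  | nil => simp [symWord, derivWord]
  | cons A w ih => rw [symWord, deriv_ins, ih, derivWord, map_add, sym_cons, sym_single, symWord]

theorem d_one (μ : Fin 4) : d odd m μ 1 = 0 := by
  have h := d_mul (odd := odd) (m := m) μ 1 1
  simpa using h

theorem wordEval_deriv (μ : Fin 4) (x : WordSpace F) :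
    wordEval odd m (deriv F μ x) = d odd m μ (wordEval odd m x) := by
  refine word_ext (f := (wordEval odd m).comp (deriv F μ))
    (g := (d odd m μ).comp (wordEval odd m)) (fun w => ?_) x
  simp only [LinearMap.comp_apply, wordEval_single, deriv_single]
  induction w with
  | nil => simp [derivWord, mono, d_one]
  | cons A w ih =>
    rw [derivWord, map_add, wordEval_single, wordEval_cons, ih, mono_cons, mono_cons, d_mul, d_y]

theorem derivWord_eq_sum (μ : Fin 4) (w : List (Jet F)) :
    derivWord μ w = ∑ i ∈ Finset.range w.length, Finsupp.single (w.modify i (Jet.diff μ)) 1 := by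
  induction w with
  | nil => rfl
  | cons A w ih =>
    rw [derivWord, ih, List.length_cons, Finset.sum_range_succ', map_sum, add_comm]
    simp

end Words

/-! ### Words as exponent vectors of momenta -/

section Encoding

/-- The exponent vector of a word: the exponent of `X (i, μ)` is the number of derivatives `d_μ`
in the letter `i`. -/
def wordExp (w : List (Jet F)) : ℕ × Fin 4 →₀ ℕ :=
  Finsupp.onFinset (Finset.range w.length ×ˢ Finset.univ)
    (fun x => ((w.map Prod.snd).getD x.1 0).count x.2) (by
      rintro ⟨i, μ⟩ h
      simp only [Finset.mem_product, Finset.mem_range, Finset.mem_univ, and_true]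
      by_contra hi
      exact h (by simp [hi]))

theorem wordExp_apply (w : List (Jet F)) (i : ℕ) (μ : Fin 4) :
    wordExp w (i, μ) = ((w.map Prod.snd).getD i 0).count μ := rfl

/-- The derivatives of the particle `i` in an exponent vector. -/
def expDerivs (n : ℕ × Fin 4 →₀ ℕ) (i : ℕ) : Multiset (Fin 4) :=
  ∑ μ, Multiset.replicate (n (i, μ)) μ

/-- The word with given fields and exponent vector. -/
def expWord (α : List F) (n : ℕ × Fin 4 →₀ ℕ) : List (Jet F) :=
  α.mapIdx fun i a => (a, expDerivs n i)

theorem count_expDerivs (n : ℕ × Fin 4 →₀ ℕ) (i : ℕ) (μ : Fin 4) :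
    (expDerivs n i).count μ = n (i, μ) := by
  simp [expDerivs, Multiset.count_sum', Multiset.count_replicate]

theorem expWord_wordExp (w : List (Jet F)) : expWord (w.map Prod.fst) (wordExp w) = w := by
  refine List.ext_getElem (by simp [expWord]) fun i h1 h2 => ?_
  simp only [expWord, List.getElem_mapIdx, List.getElem_map]
  refine Prod.ext rfl (Multiset.ext.mpr fun μ => ?_)
  rw [count_expDerivs, wordExp_apply, List.getD_eq_getElem _ _ (by simpa using h2)]
  simp

theorem length_expWord (α : List F) (n : ℕ × Fin 4 →₀ ℕ) :
    (expWord α n).length = α.length := by simp [expWord]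

theorem modify_expWord (α : List F) (n : ℕ × Fin 4 →₀ ℕ) (i : ℕ) (μ : Fin 4) :
    (expWord α n).modify i (Jet.diff μ) = expWord α (n + Finsupp.single (i, μ) 1) := by
  refine List.ext_getElem (by simp [expWord]) fun j h1 h2 => ?_
  simp only [expWord, List.getElem_modify, List.getElem_mapIdx]
  split_ifs with h
  · subst h
    refine Prod.ext rfl (Multiset.ext.mpr fun ν => ?_)
    rw [count_expDerivs, Jet.diff, Multiset.count_cons, count_expDerivs]
    simp [Finsupp.single_apply, eq_comm]
  · refine Prod.ext rfl (Multiset.ext.mpr fun ν => ?_)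
    rw [count_expDerivs, count_expDerivs]
    simp [h]

theorem wordExp_modify (w : List (Jet F)) {i : ℕ} (hi : i < w.length) (μ : Fin 4) :
    wordExp (w.modify i (Jet.diff μ)) = wordExp w + Finsupp.single (i, μ) 1 := by
  ext ⟨j, ν⟩
  rw [Finsupp.add_apply, wordExp_apply, wordExp_apply]
  by_cases hj : j < w.length
  · rw [List.getD_eq_getElem _ _ (by simpa using hj), List.getD_eq_getElem _ _ (by simpa using hj),
      List.getElem_map, List.getElem_map, List.getElem_modify]
    split_ifs with h
    · subst h
      rw [Jet.diff, Multiset.count_cons]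
      simp [Finsupp.single_apply, eq_comm]
    · simp [h]
  · have hne : i ≠ j := fun h => hj (h ▸ hi)
    rw [List.getD_eq_default _ _ (by simpa using hj), List.getD_eq_default _ _ (by simpa using hj)]
    simp [hne]

theorem map_fst_modify (w : List (Jet F)) (i : ℕ) (μ : Fin 4) :
    (w.modify i (Jet.diff μ)).map Prod.fst = w.map Prod.fst := by
  refine List.ext_getElem (by simp) fun j h1 h2 => ?_
  simp only [List.getElem_map, List.getElem_modify]
  split_ifs <;> rfl

theorem modify_append_cons (u : List (Jet F)) (B : Jet F) (v : List (Jet F)) (μ : Fin 4) :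
    (u ++ B :: v).modify u.length (Jet.diff μ) = u ++ B.diff μ :: v := by
  induction u with
  | nil => rfl
  | cons A u ih => simp [ih]

theorem sum_getD_card (l : List (Multiset (Fin 4))) :
    ∑ i ∈ Finset.range l.length, Multiset.card (l.getD i 0) = (l.map Multiset.card).sum := by
  induction l with
  | nil => rfl
  | cons a l ih =>
    rw [List.length_cons, Finset.sum_range_succ', List.map_cons, List.sum_cons, ← ih, add_comm]
    simp

/-- The total degree in the momenta counts the derivatives; canonical dimension adds one for each
field. -/
theorem weight_wordExp (w : List (Jet F)) :
    Finsupp.weight (fun _ => 1) (wordExp w) + w.length = canonicalDim w := by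
  have h1 : Finsupp.weight (fun _ => 1) (wordExp w)
      = ∑ x ∈ Finset.range w.length ×ˢ Finset.univ, wordExp w x := by
    rw [Finsupp.weight_apply, wordExp, Finsupp.onFinset_sum _ (fun _ => by simp)]
    simp
  have h2 : ∀ i, ∑ μ, wordExp w (i, μ) = Multiset.card ((w.map Prod.snd).getD i 0) := fun i => by
    simp only [wordExp_apply]
    exact Multiset.sum_count_eq_card fun a _ => Finset.mem_univ a
  rw [h1, Finset.sum_product]
  simp only [h2]
  have h3 := sum_getD_card (w.map Prod.snd)
  rw [List.length_map] at h3
  rw [h3, canonicalDim, List.sum_map_add]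
  simp [add_comm, Function.comp_def]

end Encoding

/-! ### From on-shell polynomials to momentum polynomials -/

section Reduction

variable (odd : F → Bool) (m : F → ℝ≥0)

/-- The squared masses of a list of fields. -/
def massSq (α : List F) (i : ℕ) : ℂ := ((((α.map m).getD i 0 : ℝ≥0) : ℝ) : ℂ) ^ 2

/-- The on-shell polynomial with fields `α` represented by a polynomial in the momenta. -/
def momEval (α : List F) : MomPoly →ₗ[ℂ] OnShellPoly odd m :=
  (basisMonomials (ℕ × Fin 4) ℂ).constr ℂ fun n => mono odd m (expWord α n)

variable (F) in
/-- The polynomials in the momenta which represent a linear combination of words. -/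
def wordPoly : WordSpace F →ₗ[ℂ] List F →₀ MomPoly :=
  Finsupp.linearCombination ℂ fun w => Finsupp.single (w.map Prod.fst) (monomial (wordExp w) 1)

variable {odd m}

theorem momEval_monomial (α : List F) (n : ℕ × Fin 4 →₀ ℕ) :
    momEval odd m α (monomial n 1) = mono odd m (expWord α n) := by
  have h := (basisMonomials (ℕ × Fin 4) ℂ).constr_basis ℂ (fun n => mono odd m (expWord α n)) n
  rwa [coe_basisMonomials] at h

theorem wordPoly_single (w : List (Jet F)) : wordPoly F (Finsupp.single w 1)
    = Finsupp.single (w.map Prod.fst) (monomial (wordExp w) 1) := by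
  simp [wordPoly]

theorem momPoly_ext {V : Type*} [AddCommMonoid V] [Module ℂ V] {f g : MomPoly →ₗ[ℂ] V}
    (h : ∀ n, f (monomial n 1) = g (monomial n 1)) (p : MomPoly) : f p = g p := by
  have : f = g := (basisMonomials (ℕ × Fin 4) ℂ).ext fun n => by
    rw [coe_basisMonomials]; exact h n
  rw [this]

theorem lsum_momEval_wordPoly (x : WordSpace F) :
    Finsupp.lsum ℂ (momEval odd m) (wordPoly F x) = wordEval odd m x := by
  refine word_ext (f := (Finsupp.lsum ℂ (momEval odd m)).comp (wordPoly F)) (fun w => ?_) x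
  rw [LinearMap.comp_apply, wordPoly_single, Finsupp.lsum_single, momEval_monomial,
    expWord_wordExp, wordEval_single]

theorem totalMom_mul_monomial (k : ℕ) (μ : Fin 4) (n : ℕ × Fin 4 →₀ ℕ) :
    totalMom k μ * monomial n 1
      = ∑ i ∈ Finset.range k, monomial (n + Finsupp.single (i, μ) 1) 1 := by
  rw [totalMom, Finset.sum_mul]
  refine Finset.sum_congr rfl fun i _ => ?_
  rw [X, monomial_mul, mul_one, add_comm]

/-- By the Leibniz rule `d_μ` raises one exponent `(i, μ)` at a time, summed over the letters, and
it leaves the list of fields unchanged. -/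
theorem wordPoly_deriv (μ : Fin 4) (x : WordSpace F) (α : List F) :
    wordPoly F (deriv F μ x) α = totalMom α.length μ * wordPoly F x α := by
  classical
  refine word_ext (f := (Finsupp.lapply α).comp ((wordPoly F).comp (deriv F μ)))
    (g := (LinearMap.mulLeft ℂ (totalMom α.length μ)).comp
      ((Finsupp.lapply α).comp (wordPoly F))) (fun w => ?_) x
  simp only [LinearMap.comp_apply, deriv_single, derivWord_eq_sum, map_sum, wordPoly_single,
    Finsupp.lapply_apply, LinearMap.mulLeft_apply, map_fst_modify, Finsupp.single_apply]
  split_ifs with h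
  · subst h
    rw [List.length_map, totalMom_mul_monomial]
    refine Finset.sum_congr rfl fun i hi => ?_
    rw [wordExp_modify w (Finset.mem_range.mp hi)]
  · simp

theorem d_mono (μ : Fin 4) (w : List (Jet F)) : d odd m μ (mono odd m w)
    = ∑ i ∈ Finset.range w.length, mono odd m (w.modify i (Jet.diff μ)) := by
  rw [← wordEval_single, ← wordEval_deriv, deriv_single, derivWord_eq_sum, map_sum]
  simp

theorem d_momEval (μ : Fin 4) (α : List F) (p : MomPoly) :
    d odd m μ (momEval odd m α p) = momEval odd m α (totalMom α.length μ * p) := by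
  refine momPoly_ext (f := (d odd m μ).comp (momEval odd m α))
    (g := (momEval odd m α).comp (LinearMap.mulLeft ℂ (totalMom α.length μ))) (fun n => ?_) p
  rw [LinearMap.comp_apply, LinearMap.comp_apply, LinearMap.mulLeft_apply, totalMom_mul_monomial,
    momEval_monomial, d_mono, map_sum, length_expWord]
  refine Finset.sum_congr rfl fun i _ => ?_
  rw [momEval_monomial, modify_expWord]

theorem sum_eta_smul {V : Type*} [AddCommMonoid V] [Module ℂ V] (f : Fin 4 → V) (μ : Fin 4) :
    ∑ ν, eta μ ν • f ν = etaDiag μ • f μ := by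
  rw [Finset.sum_eq_single μ]
  · simp [eta, etaDiag]
  · intro ν _ h
    simp [eta, h.symm]
  · simp

theorem mono_klein_gordon (u : List (Jet F)) (B : Jet F) (v : List (Jet F)) :
    ∑ μ, etaDiag μ • mono odd m (u ++ (B.diff μ).diff μ :: v)
      + (((m B.1 : ℝ) : ℂ) ^ 2) • mono odd m (u ++ B :: v) = 0 := by
  have h := klein_gordon odd m B
  simp only [sum_eta_smul, neg_smul] at h
  rw [← sub_eq_zero, sub_neg_eq_add] at h
  simp only [mono_append, mono_cons]
  have h2 : mono odd m u * ((∑ μ, etaDiag μ • y odd m ((B.diff μ).diff μ)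
      + (((m B.1 : ℝ) : ℂ) ^ 2) • y odd m B) * mono odd m v) = 0 := by rw [h]; simp
  rw [← h2, add_mul, mul_add, Finset.sum_mul, Finset.mul_sum]
  simp only [smul_mul_assoc, mul_smul_comm]

theorem shell_mul_monomial (M : ℕ → ℂ) (i : ℕ) (n : ℕ × Fin 4 →₀ ℕ) :
    shell M i * monomial n 1
      = ∑ μ, etaDiag μ • monomial (n + Finsupp.single (i, μ) 1 + Finsupp.single (i, μ) 1) 1
        + M i • monomial n 1 := by
  rw [shell, add_mul, Finset.sum_mul, C_mul']
  congr 1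
  refine Finset.sum_congr rfl fun μ _ => ?_
  have h : Finsupp.single (i, μ) 1 + Finsupp.single (i, μ) 1 + n
      = n + Finsupp.single (i, μ) 1 + Finsupp.single (i, μ) 1 := by abel
  rw [mul_assoc, C_mul', X, sq, monomial_mul, monomial_mul, h, mul_one, mul_one]

theorem exists_split_expWord (α : List F) {i : ℕ} (hi : i < α.length) (n : ℕ × Fin 4 →₀ ℕ) :
    ∃ u B v, expWord α n = u ++ B :: v ∧ u.length = i ∧ B.1 = α[i] := by
  have hi' : i < (expWord α n).length := by rwa [length_expWord]
  refine ⟨(expWord α n).take i, (expWord α n)[i], (expWord α n).drop (i + 1), ?_, ?_, ?_⟩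
  · rw [← List.drop_eq_getElem_cons, List.take_append_drop]
  · simp [hi'.le]
  · simp [expWord]

theorem momEval_shell (α : List F) {i : ℕ} (hi : i < α.length) (p : MomPoly) :
    momEval odd m α (shell (massSq m α) i * p) = 0 := by
  refine momPoly_ext (f := (momEval odd m α).comp (LinearMap.mulLeft ℂ (shell (massSq m α) i)))
    (g := 0) (fun n => ?_) p
  rw [LinearMap.comp_apply, LinearMap.mulLeft_apply, shell_mul_monomial]
  simp only [map_add, map_sum, map_smul, momEval_monomial, ← modify_expWord, LinearMap.zero_apply]
  obtain ⟨u, B, v, h, rfl, hB⟩ := exists_split_expWord α hi n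
  simp only [h, modify_append_cons]
  have hM : massSq m α u.length = ((m B.1 : ℝ) : ℂ) ^ 2 := by
    rw [massSq, List.getD_eq_getElem _ _ (by simpa using hi), List.getElem_map, hB]
  rw [hM]
  exact mono_klein_gordon u B v

/-- With `wordPoly_mem` this makes Klein-Gordon and the mass shell ideal correspond in both
directions. Exponents of particles beyond the list are ignored by `momEval`, so the infinitely many
variables are harmless. -/
theorem momEval_eq_zero {α : List F} {p : MomPoly}
    (hp : p ∈ shellIdeal α.length (massSq m α)) : momEval odd m α p = 0 := by
  obtain ⟨a, rfl⟩ := mem_shellIdeal.mp hp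
  rw [map_sum]
  refine Finset.sum_eq_zero fun i _ => ?_
  rw [mul_comm, momEval_shell α i.2]

theorem wordPoly_mem {x : WordSpace F} (hx : x ∈ kgSpan m) (α : List F) :
    wordPoly F x α ∈ shellIdeal α.length (massSq m α) := by
  classical
  refine (Submodule.span_le (p := ((shellIdeal α.length (massSq m α)).restrictScalars ℂ).comap
    ((Finsupp.lapply α).comp (wordPoly F)))).mpr ?_ hx
  rintro _ ⟨⟨u, B, v⟩, rfl⟩
  simp only [Submodule.comap_coe, Set.mem_preimage, SetLike.mem_coe, Submodule.restrictScalars_mem,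
    kgCons, LinearMap.add_apply, LinearMap.sum_apply, LinearMap.smul_apply, sum_eta_smul,
    consMap_single, map_add, map_sum, map_smul, prefixMap_single, LinearMap.comp_apply,
    wordPoly_single, Finsupp.lapply_apply, Finsupp.single_apply]
  have hu : u.length < (u ++ B :: v).length := by simp
  have h1 : ∀ μ, u ++ (B.diff μ).diff μ :: v
      = ((u ++ B :: v).modify u.length (Jet.diff μ)).modify u.length (Jet.diff μ) := fun μ => by
    rw [modify_append_cons, modify_append_cons]
  simp only [h1, map_fst_modify]
  split_ifs with h
  · have h2 : ∀ μ, wordExp (((u ++ B :: v).modify u.length (Jet.diff μ)).modify u.length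
        (Jet.diff μ)) = wordExp (u ++ B :: v) + Finsupp.single (u.length, μ) 1
          + Finsupp.single (u.length, μ) 1 := fun μ => by
      rw [wordExp_modify _ (by simp), wordExp_modify _ hu]
    have hM : ((m B.1 : ℝ) : ℂ) ^ 2 = massSq m α u.length := by
      rw [← h, massSq, List.getD_eq_getElem _ _ (by simp)]
      simp
    simp only [h2]
    rw [hM, ← shell_mul_monomial]
    refine Ideal.mul_mem_right _ _ (shell_mem _ ?_)
    rw [← h, List.length_map]
    exact hu
  · simp

theorem wordPoly_divFactorial (x : WordSpace F) (α : List F) :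
    wordPoly F (divFactorial F x) α = (α.length.factorial : ℂ)⁻¹ • wordPoly F x α := by
  classical
  refine word_ext (f := (Finsupp.lapply α).comp ((wordPoly F).comp (divFactorial F)))
    (g := (α.length.factorial : ℂ)⁻¹ • (Finsupp.lapply α).comp (wordPoly F)) (fun w => ?_) x
  simp only [LinearMap.comp_apply, divFactorial_single, map_smul, wordPoly_single,
    LinearMap.smul_apply, Finsupp.lapply_apply, Finsupp.single_apply]
  split_ifs with h
  · rw [← h, List.length_map]
  · simp

theorem exists_word_of_coeff_ne_zero {s : Set (List (Jet F))} {x : WordSpace F}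
    (hx : x ∈ Finsupp.supported ℂ ℂ s) {α : List F} {n : ℕ × Fin 4 →₀ ℕ}
    (h : coeff n (wordPoly F x α) ≠ 0) : ∃ w ∈ s, w.map Prod.fst = α ∧ wordExp w = n := by
  classical
  by_contra! hne
  refine h (supported_induction ((lcoeff ℂ n).comp ((Finsupp.lapply α).comp (wordPoly F))) ⊥
    (fun w hw => ?_) hx)
  simp only [LinearMap.comp_apply, wordPoly_single, Finsupp.lapply_apply, Finsupp.single_apply,
    Submodule.mem_bot]
  split_ifs with h
  · rw [lcoeff_apply, coeff_monomial, if_neg (hne w hw h)]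
  · simp

/-- A conserved current is represented by polynomials in the momenta which are conserved on the
mass shell. -/
theorem exists_conserved_representatives {s : Set (List (Jet F))} {S : Fin 4 → OnShellPoly odd m}
    (hS : ∀ μ, S μ ∈ Submodule.span ℂ (mono odd m '' s)) (hdiv : DivFree S) :
    ∃ t : Fin 4 → List F →₀ MomPoly,
      (∀ μ, S μ = (t μ).sum fun α p => momEval odd m α p) ∧
      (∀ α, ∑ μ, totalMom α.length μ * t μ α ∈ shellIdeal α.length (massSq m α)) ∧
      ∀ μ α n, coeff n (t μ α) ≠ 0 → ∃ w ∈ s, w.length = α.length ∧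
        canonicalDim w = Finsupp.weight (fun _ => 1) n + α.length ∧
        ∀ i ν, α.length ≤ i → n (i, ν) = 0 := by
  have h : ∀ μ, ∃ x ∈ Finsupp.supported ℂ ℂ s, wordEval odd m x = S μ := fun μ =>
    (Finsupp.mem_span_image_iff_linearCombination ℂ).mp (hS μ)
  choose x hxs hxS using h
  refine ⟨fun μ => wordPoly F (divFactorial F (sym odd (x μ))), fun μ => ?_, fun α => ?_,
    fun μ α n hn => ?_⟩
  · rw [← hxS, ← wordEval_divFactorial_sym, ← lsum_momEval_wordPoly]
    rfl
  -- The word-level divergence need not vanish modulo Klein-Gordon, but its symmetrization does. As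
  -- symmetrization commutes with `deriv`, the symmetrized representatives are conserved.
  · have h0 : wordEval odd m (∑ μ, deriv F μ (x μ)) = 0 := by
      rw [map_sum, ← hdiv]
      exact Finset.sum_congr rfl fun μ _ => by rw [wordEval_deriv, hxS]
    have h1 := wordPoly_mem (sym_mem_of_wordEval_eq_zero h0) α
    simp only [map_sum, ← deriv_sym, Finsupp.finsetSum_apply, wordPoly_deriv] at h1
    simp only [wordPoly_divFactorial, mul_smul_comm, ← Finset.smul_sum]
    exact Submodule.smul_of_tower_mem _ _ h1
  · obtain ⟨w, ⟨v, hv, hl, hd⟩, rfl, rfl⟩ :=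
      exists_word_of_coeff_ne_zero (divFactorial_sym_supported (hxs μ)) hn
    refine ⟨v, hv, by simp [hl], ?_, fun i ν hi => ?_⟩
    · rw [← hd, ← weight_wordExp, List.length_map]
    · rw [wordExp_apply, List.getD_eq_default _ _ (by simpa using hi), Multiset.count_zero]

end Reduction

/-! ### Classification of conserved currents -/

section Currents

variable (odd : F → Bool) (m : F → ℝ≥0)

/-- The trivially conserved currents. -/
def trivialCurrents : Submodule ℂ (Fin 4 → OnShellPoly odd m) where
  carrier := {S | ∃ T, Antisymm T ∧ ∀ μ, S μ = divergence T μ}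
  add_mem' := by
    rintro S S' ⟨T, hT, hS⟩ ⟨T', hT', hS'⟩
    refine ⟨T + T', fun μ ν => ?_, fun μ => ?_⟩
    · simp only [Pi.add_apply]
      rw [hT μ ν, hT' μ ν, neg_add]
    · simp only [Pi.add_apply, hS, hS', divergence, map_add, Finset.sum_add_distrib]
  zero_mem' := ⟨0, fun _ _ => by simp, fun _ => by simp [divergence]⟩
  smul_mem' := by
    rintro c S ⟨T, hT, hS⟩
    refine ⟨c • T, fun μ ν => ?_, fun μ => ?_⟩
    · simp only [Pi.smul_apply]
      rw [hT μ ν, smul_neg]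
    · simp only [Pi.smul_apply, hS, divergence, map_smul, Finset.smul_sum]

/-- The bilinear currents `y^A d^μ y^B - d^μ y^A y^B`. -/
def bilinearCurrent (p : Jet F × Jet F) (μ : Fin 4) : OnShellPoly odd m :=
  y odd m p.1 * dUp odd m μ (y odd m p.2)
    - fieldSign odd p.1.1 p.2.1 • (y odd m p.2 * dUp odd m μ (y odd m p.1))

/-- The linear currents `d^μ y^A`. -/
def linearCurrent (A : Jet F) (μ : Fin 4) : OnShellPoly odd m := dUp odd m μ (y odd m A)

/-- The sums of trivial currents, of bilinear currents of fields of equal mass with labels in `JB`,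
and of linear currents of massless fields with labels in `JL`. -/
def currentSpace (JB : Set (Jet F × Jet F)) (JL : Set (Jet F)) :
    Submodule ℂ (Fin 4 → OnShellPoly odd m) :=
  (Submodule.span ℂ (bilinearCurrent odd m '' {p | p ∈ JB ∧ m p.1.1 = m p.2.1}) ⊔
    Submodule.span ℂ (linearCurrent odd m '' {A | A ∈ JL ∧ m A.1 = 0})) ⊔ trivialCurrents odd m

variable {odd m}

theorem trivialCurrents_le (JB : Set (Jet F × Jet F)) (JL : Set (Jet F)) :
    trivialCurrents odd m ≤ currentSpace odd m JB JL := le_sup_right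

theorem bilinearCurrent_mem {JB : Set (Jet F × Jet F)} (JL : Set (Jet F)) {A B : Jet F}
    (h : (A, B) ∈ JB) (hm : m A.1 = m B.1) :
    bilinearCurrent odd m (A, B) ∈ currentSpace odd m JB JL :=
  Submodule.mem_sup_left (Submodule.mem_sup_left (Submodule.subset_span ⟨_, ⟨h, hm⟩, rfl⟩))

theorem linearCurrent_mem (JB : Set (Jet F × Jet F)) {JL : Set (Jet F)} {A : Jet F}
    (h : A ∈ JL) (hm : m A.1 = 0) : linearCurrent odd m A ∈ currentSpace odd m JB JL :=
  Submodule.mem_sup_left (Submodule.mem_sup_right (Submodule.subset_span ⟨_, ⟨h, hm⟩, rfl⟩))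

theorem dUp_apply (μ : Fin 4) (p : OnShellPoly odd m) :
    dUp odd m μ p = etaDiag μ • d odd m μ p := by
  rw [dUp, LinearMap.sum_apply, ← sum_eta_smul (fun ν => d odd m ν p)]
  rfl

theorem momEval_C_mul (α : List F) (c : ℂ) (p : MomPoly) :
    momEval odd m α (C c * p) = c • momEval odd m α p := by
  rw [C_mul', map_smul]

/-- `momEval` kills the mass shell ideal and turns multiplication by `P_ν` into `d_ν`, so Koszul
form on shell becomes a divergence. -/
theorem trivial_of_mem_ideal {α : List F} {t : Fin 4 → MomPoly} {T : Fin 4 → Fin 4 → MomPoly}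
    (hT : ∀ μ ν, T μ ν = -T ν μ)
    (h : ∀ μ, t μ - ∑ ν, totalMom α.length ν * T μ ν ∈ shellIdeal α.length (massSq m α)) :
    (fun μ => momEval odd m α (t μ)) ∈ trivialCurrents odd m := by
  refine ⟨fun μ ν => momEval odd m α (T μ ν), fun μ ν => ?_, fun μ => ?_⟩
  · beta_reduce
    rw [hT, map_neg]
  · have h0 := momEval_eq_zero (odd := odd) (h μ)
    rw [map_sub, sub_eq_zero, map_sum] at h0
    simp only [h0, divergence, d_momEval]

theorem momEval_mem_of_many {α : List F} (hα : 3 ≤ α.length) {t : Fin 4 → MomPoly}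
    (ht : ∑ μ, totalMom α.length μ * t μ ∈ shellIdeal α.length (massSq m α)) :
    (fun μ => momEval odd m α (t μ)) ∈ trivialCurrents odd m := by
  obtain ⟨k, hk⟩ := Nat.exists_eq_add_of_le' hα
  rw [hk] at ht
  obtain ⟨T, hT, h⟩ := exists_trivial_many k _ ht
  rw [← hk] at h
  exact trivial_of_mem_ideal hT h

theorem massSq_zero (a : F) (α : List F) : massSq m (a :: α) 0 = ((m a : ℝ) : ℂ) ^ 2 := by
  rfl

theorem massSq_one (a b : F) (α : List F) : massSq m (a :: b :: α) 1 = ((m b : ℝ) : ℂ) ^ 2 := by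
  rfl

theorem massSq_inj {a b : F} (h : ((m a : ℝ) : ℂ) ^ 2 = ((m b : ℝ) : ℂ) ^ 2) : m a = m b := by
  have h1 : (m a : ℝ) ^ 2 = (m b : ℝ) ^ 2 := by exact_mod_cast h
  exact NNReal.coe_injective ((sq_eq_sq₀ (m a).2 (m b).2).mp h1)

theorem expWord_one (a : F) (n : ℕ × Fin 4 →₀ ℕ) : expWord [a] n = [(a, expDerivs n 0)] := rfl

theorem expWord_two (a b : F) (n : ℕ × Fin 4 →₀ ℕ) :
    expWord [a, b] n = [(a, expDerivs n 0), (b, expDerivs n 1)] := rfl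

theorem expDerivs_add_single (n : ℕ × Fin 4 →₀ ℕ) (i j : ℕ) (μ : Fin 4) :
    expDerivs (n + Finsupp.single (j, μ) 1) i
      = if i = j then μ ::ₘ expDerivs n i else expDerivs n i := by
  refine Multiset.ext.mpr fun ν => ?_
  split_ifs with h
  · rw [count_expDerivs, Multiset.count_cons, count_expDerivs]
    simp [Finsupp.single_apply, h, eq_comm]
  · rw [count_expDerivs, count_expDerivs]
    simp [Ne.symm h]

/-- A linear combination of currents built from monomials. -/
theorem momEval_mem_of_monomial {α : List F} (f : Fin 4 → MomPoly)
    {V : Submodule ℂ (Fin 4 → OnShellPoly odd m)} (p : MomPoly)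
    (h : ∀ n, coeff n p ≠ 0 → (fun μ => momEval odd m α (f μ * monomial n 1)) ∈ V) :
    (fun μ => momEval odd m α (f μ * p)) ∈ V := by
  have hp : (fun μ => momEval odd m α (f μ * p))
      = ∑ n ∈ p.support, coeff n p • fun μ => momEval odd m α (f μ * monomial n 1) := by
    funext μ
    conv_lhs => rw [p.as_sum, Finset.mul_sum, map_sum]
    rw [Finset.sum_apply]
    refine Finset.sum_congr rfl fun n _ => ?_
    rw [Pi.smul_apply, ← map_smul, ← mul_smul_comm, smul_monomial, smul_eq_mul, mul_one]
  rw [hp]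
  exact Submodule.sum_mem _ fun n hn => Submodule.smul_mem _ _ (h n (mem_support_iff.mp hn))

/-- The factor `p_1` differentiates the second letter and `p_0` the first; reordering `d^μ y^A y^B`
yields the sign in `bilinearCurrent`. -/
theorem momEval_two_monomial (a b : F) (n : ℕ × Fin 4 →₀ ℕ) :
    (fun μ => momEval odd m [a, b] (C (etaDiag μ) * (X (1, μ) - X (0, μ)) * monomial n 1))
      = bilinearCurrent odd m ((a, expDerivs n 0), (b, expDerivs n 1)) := by
  funext μ
  have hX : ∀ j, (X (j, μ) * monomial n 1 : MomPoly)
      = monomial (n + Finsupp.single (j, μ) 1) 1 := fun j => by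
    rw [X, monomial_mul, mul_one, add_comm]
  rw [mul_assoc, momEval_C_mul, sub_mul, hX, hX, map_sub, momEval_monomial, momEval_monomial,
    expWord_two, expWord_two]
  simp only [expDerivs_add_single, if_true, zero_ne_one, one_ne_zero, if_false, mono,
    List.map_cons, List.map_nil, List.prod_cons, List.prod_nil, mul_one, bilinearCurrent, dUp_apply,
    d_y, Jet.diff, mul_smul_comm, smul_sub]
  rw [y_mul_y odd m (a, μ ::ₘ expDerivs n 0) (b, expDerivs n 1), smul_comm]

theorem momEval_mem_of_two (a b : F) {t : Fin 4 → MomPoly}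
    (ht : ∑ μ, totalMom 2 μ * t μ ∈ shellIdeal 2 (massSq m [a, b])) (JL : Set (Jet F)) :
    (fun μ => momEval odd m [a, b] (t μ)) ∈ currentSpace odd m Set.univ JL := by
  by_cases hm : m a = m b
  · obtain ⟨e, he⟩ := mem_shellIdeal.mp ht
    rw [Fin.sum_univ_two] at he
    obtain ⟨T, hT, h⟩ := exists_form_two (by rw [massSq_zero, massSq_one, hm]) he.symm
    have h1 := trivialCurrents_le (odd := odd) Set.univ JL
      (trivial_of_mem_ideal (α := [a, b]) hT h)
    have h2 : (fun μ => momEval odd m [a, b] (C (etaDiag μ) * (X (1, μ) - X (0, μ)) * e 1))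
        ∈ currentSpace odd m Set.univ JL :=
      momEval_mem_of_monomial _ _ fun n _ => by
        rw [momEval_two_monomial]
        exact bilinearCurrent_mem _ (Set.mem_univ _) hm
    convert add_mem h1 h2 using 1
    funext μ
    rw [Pi.add_apply, ← map_add, sub_add_cancel]
  · obtain ⟨T, hT, h⟩ := exists_trivial_two
      (fun h => hm (massSq_inj (by rwa [massSq_zero, massSq_one] at h))) ht
    exact trivialCurrents_le _ _ (trivial_of_mem_ideal (α := [a, b]) hT h)

theorem expDerivs_zero (i : ℕ) : expDerivs 0 i = 0 := by simp [expDerivs]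

theorem momEval_mem_of_two_low_degree (a b : F) {t : Fin 4 → MomPoly}
    (ht : ∑ μ, totalMom 2 μ * t μ ∈ shellIdeal 2 (massSq m [a, b])) {k : ℕ} (hk1 : k ≤ 1)
    (hk : ∀ μ n, coeff n (t μ) ≠ 0 → Finsupp.weight (fun _ => 1) n = k) (JL : Set (Jet F))
    (JB : Set (Jet F × Jet F)) (hJB : k = 1 → ((a, 0), (b, 0)) ∈ JB) :
    (fun μ => momEval odd m [a, b] (t μ)) ∈ currentSpace odd m JB JL := by
  by_cases hm : m a = m b
  · obtain ⟨e, c, hc, he⟩ := exists_const_coeff_two k hk1 hk ht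
    obtain ⟨T, hT, h⟩ := exists_form_two (by rw [massSq_zero, massSq_one, hm]) he
    have h1 := trivialCurrents_le (odd := odd) JB JL
      (trivial_of_mem_ideal (α := [a, b]) hT h)
    have h2 : (fun μ => momEval odd m [a, b] (C (etaDiag μ) * (X (1, μ) - X (0, μ)) * C c))
        ∈ currentSpace odd m JB JL := by
      -- The coefficient is a constant, so the only monomial is `n = 0` and neither letter carries a
      -- derivative. For `k = 0` the constant vanishes.
      refine momEval_mem_of_monomial _ _ fun n hn => ?_
      rw [coeff_C] at hn
      have hn0 : n = 0 := by
        by_contra h0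
        exact hn (if_neg (Ne.symm h0))
      have hk0 : k ≠ 0 := fun h0 => hn (by rw [hc h0, ite_self])
      rw [momEval_two_monomial, hn0, expDerivs_zero, expDerivs_zero]
      exact bilinearCurrent_mem _ (hJB (by omega)) hm
    convert add_mem h1 h2 using 1
    funext μ
    rw [Pi.add_apply, ← map_add, sub_add_cancel]
  · obtain ⟨T, hT, h⟩ := exists_trivial_two
      (fun h => hm (massSq_inj (by rwa [massSq_zero, massSq_one] at h))) ht
    exact trivialCurrents_le _ _ (trivial_of_mem_ideal (α := [a, b]) hT h)

theorem momEval_one_monomial (a : F) (n : ℕ × Fin 4 →₀ ℕ) :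
    (fun μ => momEval odd m [a] (C (etaDiag μ) * X (0, μ) * monomial n 1))
      = linearCurrent odd m (a, expDerivs n 0) := by
  funext μ
  rw [mul_assoc, momEval_C_mul, X, monomial_mul, mul_one, add_comm, momEval_monomial, expWord_one,
    expDerivs_add_single, if_pos rfl, linearCurrent, dUp_apply, d_y]
  simp [mono, Jet.diff]

theorem momEval_mem_of_massive (a : F) (ha : m a ≠ 0) {t : Fin 4 → MomPoly}
    (ht : ∑ μ, totalMom 1 μ * t μ ∈ shellIdeal 1 (massSq m [a])) :
    (fun μ => momEval odd m [a] (t μ)) ∈ trivialCurrents odd m := by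
  obtain ⟨T, hT, h⟩ := exists_trivial_one_massive (by simpa [massSq_zero] using ha) ht
  exact trivial_of_mem_ideal (α := [a]) hT h

theorem momEval_mem_of_massless (a : F) (ha : m a = 0) {t : Fin 4 → MomPoly} {g : MomPoly}
    {T : Fin 4 → Fin 4 → MomPoly} (hT : ∀ μ ν, T μ ν = -T ν μ)
    (h : ∀ μ, t μ = C (etaDiag μ) * X (0, μ) * g + ∑ ν, totalMom 1 ν * T μ ν)
    (JB : Set (Jet F × Jet F)) {JL : Set (Jet F)}
    (hg : ∀ n, coeff n g ≠ 0 → (a, expDerivs n 0) ∈ JL) :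
    (fun μ => momEval odd m [a] (t μ)) ∈ currentSpace odd m JB JL := by
  have h1 := trivialCurrents_le (odd := odd) (m := m) JB JL
    (trivial_of_mem_ideal (α := [a]) (t := fun μ => ∑ ν, totalMom 1 ν * T μ ν) hT
      (fun μ => by simp))
  have h2 : (fun μ => momEval odd m [a] (C (etaDiag μ) * X (0, μ) * g))
      ∈ currentSpace odd m JB JL :=
    momEval_mem_of_monomial _ _ fun n hn => by
      rw [momEval_one_monomial]
      exact linearCurrent_mem _ (hg n hn) ha
  convert add_mem h2 h1 using 1
  funext μ
  rw [Pi.add_apply, ← map_add, h]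

theorem momEval_mem_of_one (a : F) {t : Fin 4 → MomPoly}
    (ht : ∑ μ, totalMom 1 μ * t μ ∈ shellIdeal 1 (massSq m [a])) (JB : Set (Jet F × Jet F)) :
    (fun μ => momEval odd m [a] (t μ)) ∈ currentSpace odd m JB Set.univ := by
  by_cases ha : m a = 0
  · obtain ⟨g, T, hT, h⟩ := exists_form_one_massless (by simp [massSq_zero, ha]) ht
    exact momEval_mem_of_massless a ha hT h JB fun _ _ => Set.mem_univ _
  · exact trivialCurrents_le _ _ (momEval_mem_of_massive a ha ht)

theorem weight_firstWeight (n : ℕ × Fin 4 →₀ ℕ) :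
    Finsupp.weight firstWeight n = Multiset.card (expDerivs n 0) := by
  have h : Multiset.card (expDerivs n 0) = ∑ μ, n (0, μ) := by simp [expDerivs]
  rw [h]
  induction n using Finsupp.induction_linear with
  | zero => simp
  | add x y hx hy =>
    rw [map_add, hx (by simp [expDerivs]), hy (by simp [expDerivs]), ← Finset.sum_add_distrib]
    rfl
  | single x c =>
    obtain ⟨i, ν⟩ := x
    rw [Finsupp.weight_single, firstWeight]
    by_cases hi : i = 0
    · subst hi
      simp [Finsupp.single_apply]
    · simp [hi]

/-- `firstWeight` counts the derivatives that `expDerivs` sees in the letter 0, and the constant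
weight counts the canonical dimension; they agree when only one particle occurs. -/
theorem weight_firstWeight_of_support {n : ℕ × Fin 4 →₀ ℕ} (h : ∀ i ν, 1 ≤ i → n (i, ν) = 0) :
    Finsupp.weight firstWeight n = Finsupp.weight (fun _ => 1) n := by
  rw [Finsupp.weight_apply, Finsupp.weight_apply]
  refine Finset.sum_congr rfl fun x hx => ?_
  have : x.1 = 0 := by
    by_contra hne
    exact Finsupp.mem_support_iff.mp hx (h x.1 x.2 (Nat.one_le_iff_ne_zero.mpr hne))
  simp [firstWeight, this]

theorem momEval_mem_of_one_homogeneous (a : F) {t : Fin 4 → MomPoly}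
    (ht : ∑ μ, totalMom 1 μ * t μ ∈ shellIdeal 1 (massSq m [a])) {k : ℕ}
    (hk : ∀ μ n, coeff n (t μ) ≠ 0 → Finsupp.weight (fun _ => 1) n = k + 1)
    (hsupp : ∀ μ n, coeff n (t μ) ≠ 0 → ∀ i ν, 1 ≤ i → n (i, ν) = 0)
    (JB : Set (Jet F × Jet F)) {JL : Set (Jet F)}
    (hJL : ∀ M : Multiset (Fin 4), Multiset.card M = k → (a, M) ∈ JL) :
    (fun μ => momEval odd m [a] (t μ)) ∈ currentSpace odd m JB JL := by
  by_cases ha : m a = 0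
  · obtain ⟨g, T, hT, hg, h⟩ := homogeneous_form_one_massless (by simp [massSq_zero, ha]) ht k
      (fun μ n hn => by rw [weight_firstWeight_of_support (hsupp μ n hn), hk μ n hn])
    exact momEval_mem_of_massless a ha hT h JB fun n hn =>
      hJL _ (by rw [← weight_firstWeight, hg n hn])
  · exact trivialCurrents_le _ _ (momEval_mem_of_massive a ha ht)

/-- A current is of a given form if its components with a definite list of fields are. -/
theorem mem_of_representatives {V : Submodule ℂ (Fin 4 → OnShellPoly odd m)}
    {S : Fin 4 → OnShellPoly odd m} {t : Fin 4 → List F →₀ MomPoly}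
    (hS : ∀ μ, S μ = (t μ).sum fun α p => momEval odd m α p)
    (h : ∀ α, (fun μ => momEval odd m α (t μ α)) ∈ V) : S ∈ V := by
  classical
  have hsum : S = ∑ α ∈ Finset.univ.biUnion fun μ => (t μ).support,
      fun μ => momEval odd m α (t μ α) := by
    funext μ
    rw [hS, Finset.sum_apply]
    exact Finsupp.sum_of_support_subset _
      (Finset.subset_biUnion_of_mem (fun μ => (t μ).support) (Finset.mem_univ μ)) _ (by simp)
  rw [hsum]
  exact Submodule.sum_mem _ fun α _ => h α

theorem canonicalDim_eq_zero {w : List (Jet F)} (h : w.length = 0) : canonicalDim w = 0 := by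
  rw [List.length_eq_zero_iff.mp h]
  rfl

theorem current_form {s : Set (List (Jet F))} (hs : ∀ w ∈ s, w.length ≠ 0)
    {S : Fin 4 → OnShellPoly odd m} (hS : ∀ μ, S μ ∈ Submodule.span ℂ (mono odd m '' s))
    (hdiv : DivFree S) : S ∈ currentSpace odd m Set.univ Set.univ := by
  obtain ⟨t, ht, hcons, hsupp⟩ := exists_conserved_representatives hS hdiv
  refine mem_of_representatives ht fun α => ?_
  match α with
  | [] =>
    have h0 : ∀ μ, t μ [] = 0 := fun μ => by
      ext n
      by_contra hn
      obtain ⟨w, hw, hl, -⟩ := hsupp μ [] n hn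
      exact hs w hw hl
    simp only [h0, map_zero]
    exact zero_mem _
  | [a] => exact momEval_mem_of_one a (hcons [a]) _
  | [a, b] => exact momEval_mem_of_two a b (hcons [a, b]) _
  | a :: b :: c :: α =>
    exact trivialCurrents_le _ _ (momEval_mem_of_many (by simp) (hcons _))

theorem current_form_many {s : Set (List (Jet F))} (hs : ∀ w ∈ s, 3 ≤ w.length)
    {S : Fin 4 → OnShellPoly odd m} (hS : ∀ μ, S μ ∈ Submodule.span ℂ (mono odd m '' s))
    (hdiv : DivFree S) : S ∈ trivialCurrents odd m := by
  obtain ⟨t, ht, hcons, hsupp⟩ := exists_conserved_representatives hS hdiv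
  refine mem_of_representatives ht fun α => ?_
  by_cases hα : 3 ≤ α.length
  · exact momEval_mem_of_many hα (hcons α)
  · have h0 : ∀ μ, t μ α = 0 := fun μ => by
      ext n
      by_contra hn
      obtain ⟨w, hw, hl, -⟩ := hsupp μ α n hn
      exact hα (hl ▸ hs w hw)
    simp only [h0, map_zero]
    exact zero_mem _

/-- The labels of the bilinear currents of canonical dimension `k + 2`, for `k ≤ 1`. -/
def bilinearLabels (F : Type*) (k : ℕ) : Set (Jet F × Jet F) :=
  {p | k = 1 ∧ p.1.2 = 0 ∧ p.2.2 = 0}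

theorem current_form_dimEq {k : ℕ} (hk : k ≤ 1) {S : Fin 4 → OnShellPoly odd m}
    (hS : ∀ μ, S μ ∈ dimEq odd m (k + 2)) (hdiv : DivFree S) :
    S ∈ currentSpace odd m (bilinearLabels F k) {A | Multiset.card A.2 = k} := by
  obtain ⟨t, ht, hcons, hsupp⟩ := exists_conserved_representatives hS hdiv
  have hdim : ∀ {μ α n}, coeff n (t μ α) ≠ 0 →
      Finsupp.weight (fun _ => 1) n + α.length = k + 2 := fun {μ α n} hn => by
    obtain ⟨w, hw, -, hd, -⟩ := hsupp μ α n hn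
    rw [← hd]
    exact hw
  refine mem_of_representatives ht fun α => ?_
  match α with
  | [] =>
    have h0 : ∀ μ, t μ [] = 0 := fun μ => by
      ext n
      by_contra hn
      obtain ⟨w, hw, hl, -⟩ := hsupp μ [] n hn
      have hw' : canonicalDim w = k + 2 := hw
      rw [canonicalDim_eq_zero hl] at hw'
      omega
    simp only [h0, map_zero]
    exact zero_mem _
  | [a] =>
    exact momEval_mem_of_one_homogeneous a (hcons [a])
      -- One field accounts for one unit of dimension, leaving `k + 1` derivatives; one of them is
      -- the `d^μ` of the linear current, so its label has `k`.
      (fun μ n hn => by have := hdim hn; simp only [List.length_singleton] at this; omega)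
      (fun μ n hn => by
        obtain ⟨w, -, -, -, h⟩ := hsupp μ [a] n hn
        exact h) _ (fun M hM => hM)
  | [a, b] =>
    exact momEval_mem_of_two_low_degree a b (hcons [a, b]) hk
      (fun μ n hn => by
        have := hdim hn
        simp only [List.length_cons, List.length_nil] at this
        omega) _ _
      (fun h => ⟨h, rfl, rfl⟩)
  | a :: b :: c :: α =>
    exact trivialCurrents_le _ _ (momEval_mem_of_many (by simp) (hcons _))

end Currents

/-! ### Constants with the required symmetry -/

section Coefficients

variable {odd : F → Bool} {m : F → ℝ≥0}

variable (odd) in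
/-- Graded antisymmetrization of coefficients. -/
def gradedAntisymm : (Jet F × Jet F →₀ ℂ) →ₗ[ℂ] Jet F × Jet F →₀ ℂ :=
  Finsupp.linearCombination ℂ fun p =>
    Finsupp.single p 1 - fieldSign odd p.1.1 p.2.1 • Finsupp.single p.swap 1

theorem gradedAntisymm_apply (b : Jet F × Jet F →₀ ℂ) (A B : Jet F) :
    gradedAntisymm odd b (A, B) = b (A, B) - fieldSign odd A.1 B.1 * b (B, A) := by
  classical
  induction b using Finsupp.induction_linear with
  | zero => simp
  | add x y hx hy => rw [map_add, Finsupp.add_apply, hx, hy, Finsupp.add_apply,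
      Finsupp.add_apply]; ring
  | single p c =>
    obtain ⟨P, Q⟩ := p
    have h : ((Q, P) = (A, B)) ↔ ((P, Q) = (B, A)) := by
      simp only [Prod.mk.injEq]; exact and_comm
    simp only [gradedAntisymm, Finsupp.linearCombination_single, Finsupp.smul_apply,
      Finsupp.sub_apply, Finsupp.single_apply, Prod.swap_prod_mk, smul_eq_mul, h]
    split_ifs with h1 h2 h2
    · obtain ⟨rfl, rfl⟩ := Prod.mk.inj h1
      ring
    · ring
    · obtain ⟨rfl, rfl⟩ := Prod.mk.inj h2
      rw [fieldSign_comm]; ring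
    · ring

/-- Each bilinear current is itself graded antisymmetric in its labels, so arbitrary coefficients of
these currents amount to antisymmetrized coefficients of the products `y^A d^μ y^B`. -/
theorem sum_gradedAntisymm (b : Jet F × Jet F →₀ ℂ) (μ : Fin 4) :
    ((gradedAntisymm odd b).sum fun AB c =>
        c • (y odd m AB.1 * dUp odd m μ (y odd m AB.2)))
      = Finsupp.linearCombination ℂ (bilinearCurrent odd m) b μ := by
  have h : ((gradedAntisymm odd b).sum fun AB c =>
        c • (y odd m AB.1 * dUp odd m μ (y odd m AB.2)))
      = Finsupp.linearCombination ℂ (fun AB : Jet F × Jet F =>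
        y odd m AB.1 * dUp odd m μ (y odd m AB.2)) (gradedAntisymm odd b) := rfl
  rw [h]
  induction b using Finsupp.induction_linear with
  | zero => simp
  | add x y hx hy => rw [map_add, map_add, map_add, Pi.add_apply, hx, hy] <;> rfl
  | single p c => simp [gradedAntisymm, bilinearCurrent]

theorem exists_coefficients {JB : Set (Jet F × Jet F)} {JL : Set (Jet F)}
    {S : Fin 4 → OnShellPoly odd m} (hS : S ∈ currentSpace odd m JB JL) :
    ∃ (c₂ : Jet F × Jet F →₀ ℂ) (c₁ : Jet F →₀ ℂ) (T : Fin 4 → Fin 4 → OnShellPoly odd m),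
      (∀ A B, c₂ (A, B) = -(fieldSign odd A.1 B.1 * c₂ (B, A))) ∧
      (∀ A B, c₂ (A, B) ≠ 0 → m A.1 = m B.1) ∧
      (∀ A, c₁ A ≠ 0 → m A.1 = 0) ∧
      Antisymm T ∧
      (∀ A B, c₂ (A, B) ≠ 0 → (A, B) ∈ JB ∨ (B, A) ∈ JB) ∧
      (∀ A, c₁ A ≠ 0 → A ∈ JL) ∧
      ∀ μ, S μ = c₂.sum (fun AB c => c • (y odd m AB.1 * dUp odd m μ (y odd m AB.2))) +
        c₁.sum (fun A c => c • dUp odd m μ (y odd m A)) + divergence T μ := by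
  obtain ⟨S', hS', S₃, ⟨T, hT, hTS⟩, rfl⟩ := Submodule.mem_sup.mp hS
  obtain ⟨S₂, hS₂, S₁, hS₁, rfl⟩ := Submodule.mem_sup.mp hS'
  obtain ⟨b, hb, rfl⟩ := (Finsupp.mem_span_image_iff_linearCombination ℂ).mp hS₂
  obtain ⟨c₁, hc₁, rfl⟩ := (Finsupp.mem_span_image_iff_linearCombination ℂ).mp hS₁
  have hb' : ∀ A B, b (A, B) ≠ 0 → (A, B) ∈ JB ∧ m A.1 = m B.1 := fun A B h =>
    (Finsupp.mem_supported _ _).mp hb (Finsupp.mem_support_iff.mpr h)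
  have hc₁' : ∀ A, c₁ A ≠ 0 → A ∈ JL ∧ m A.1 = 0 := fun A h =>
    (Finsupp.mem_supported _ _).mp hc₁ (Finsupp.mem_support_iff.mpr h)
  have hor : ∀ A B, gradedAntisymm odd b (A, B) ≠ 0 → b (A, B) ≠ 0 ∨ b (B, A) ≠ 0 := by
    intro A B h
    rw [gradedAntisymm_apply] at h
    by_contra! h0
    exact h (by rw [h0.1, h0.2]; ring)
  refine ⟨gradedAntisymm odd b, c₁, T, fun A B => ?_, fun A B h => ?_, fun A h => (hc₁' A h).2, hT,
    fun A B h => ?_, fun A h => (hc₁' A h).1, fun μ => ?_⟩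
  · rw [gradedAntisymm_apply, gradedAntisymm_apply, fieldSign_comm B.1]
    linear_combination (-b (A, B)) * fieldSign_mul_self (odd := odd) A.1 B.1
  · rcases hor A B h with h | h
    · exact (hb' _ _ h).2
    · exact (hb' _ _ h).2.symm
  · exact (hor A B h).imp (fun h => (hb' _ _ h).1) fun h => (hb' _ _ h).1
  · rw [sum_gradedAntisymm, Pi.add_apply, Pi.add_apply, hTS]
    congr 2
    rw [Finsupp.linearCombination_apply, Finsupp.sum, Finset.sum_apply]
    rfl

theorem finsupp_sum_eq_sum_of_range {X K V : Type*} [Fintype K] [AddCommMonoid V] {e : K → X}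
    (he : Function.Injective e) {c : X →₀ ℂ} (hc : ∀ x, c x ≠ 0 → x ∈ Set.range e)
    (f : X → ℂ → V) (hf : ∀ x, f x 0 = 0) : c.sum f = ∑ k, f (e k) (c (e k)) := by
  classical
  rw [Finsupp.sum_of_support_subset c (s := Finset.univ.image e) (fun x hx => by
    obtain ⟨k, rfl⟩ := hc x (Finsupp.mem_support_iff.mp hx)
    exact Finset.mem_image_of_mem _ (Finset.mem_univ _)) f fun x _ => hf x,
    Finset.sum_image fun _ _ _ _ h => he h]

end Coefficients

/-! ### Conservation of the listed currents -/

section Converse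

variable {odd : F → Bool} {m : F → ℝ≥0}

theorem d_comm (μ ν : Fin 4) (p : OnShellPoly odd m) :
    d odd m μ (d odd m ν p) = d odd m ν (d odd m μ p) := by
  obtain ⟨x, rfl⟩ := mk_surjective odd m p
  induction x using FreeAlgebra.induction with
  | grade0 r =>
    rw [AlgHom.commutes, Algebra.algebraMap_eq_smul_one]
    simp [d_one]
  | grade1 A =>
    change d odd m μ (d odd m ν (y odd m A)) = d odd m ν (d odd m μ (y odd m A))
    rw [d_y, d_y, d_y, d_y]
    simp only [Jet.diff, Multiset.cons_swap μ ν]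
  | add a b ha hb => simp only [map_add, ha, hb]
  | mul a b ha hb =>
    simp only [map_mul, d_mul, map_add, ha, hb]
    abel

variable (odd m) in
/-- The divergence `d_μ S^μ`. -/
def div : (Fin 4 → OnShellPoly odd m) →ₗ[ℂ] OnShellPoly odd m :=
  ∑ μ, (d odd m μ).comp (LinearMap.proj μ)

theorem div_apply (S : Fin 4 → OnShellPoly odd m) : div odd m S = ∑ μ, d odd m μ (S μ) := by
  simp [div]

theorem eq_zero_of_eq_neg {V : Type*} [AddCommGroup V] [Module ℂ V] {x : V} (h : x = -x) :
    x = 0 := by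
  have h2 : (2 : ℂ) • x = 0 := by rw [two_smul]; nth_rewrite 1 [h]; exact neg_add_cancel x
  exact (smul_eq_zero.mp h2).resolve_left two_ne_zero

theorem sum_sum_eq_zero {V K : Type*} [AddCommGroup V] [Module ℂ V] (s : Finset K) {f : K → K → V}
    (h : ∀ a b, f a b = -f b a) : ∑ a ∈ s, ∑ b ∈ s, f a b = 0 := by
  refine eq_zero_of_eq_neg ?_
  conv_lhs => rw [Finset.sum_comm]
  simp only [← Finset.sum_neg_distrib]
  exact Finset.sum_congr rfl fun a _ => Finset.sum_congr rfl fun b _ => h b a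

theorem div_divergence {T : Fin 4 → Fin 4 → OnShellPoly odd m} (hT : Antisymm T) :
    div odd m (divergence T) = 0 := by
  simp only [div_apply, divergence, map_sum]
  refine sum_sum_eq_zero _ fun μ ν => ?_
  rw [hT μ ν, map_neg, map_neg, d_comm]

theorem div_linearCurrent (A : Jet F) :
    div odd m (linearCurrent odd m A) = (-(((m A.1 : ℝ) : ℂ) ^ 2)) • y odd m A := by
  rw [← klein_gordon, div_apply]
  refine Finset.sum_congr rfl fun μ _ => ?_
  rw [sum_eta_smul, linearCurrent, dUp_apply, map_smul, d_y, d_y]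

variable (odd m) in
/-- The current `y^A d^μ y^B`. -/
def pairCurrent (A B : Jet F) (μ : Fin 4) : OnShellPoly odd m :=
  y odd m A * dUp odd m μ (y odd m B)

theorem div_pairCurrent (A B : Jet F) : div odd m (pairCurrent odd m A B)
    = ∑ μ, etaDiag μ • (y odd m (A.diff μ) * y odd m (B.diff μ))
      - (((m B.1 : ℝ) : ℂ) ^ 2) • (y odd m A * y odd m B) := by
  have h := div_linearCurrent (odd := odd) (m := m) B
  rw [div_apply] at h
  simp only [div_apply, pairCurrent, d_mul, Finset.sum_add_distrib, ← Finset.mul_sum]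
  rw [sub_eq_add_neg, ← neg_smul, ← mul_smul_comm, ← h]
  congr 1
  refine Finset.sum_congr rfl fun μ _ => ?_
  rw [dUp_apply, d_y, d_y, mul_smul_comm]

/-- By `div_pairCurrent` the divergence consists of a contraction of first derivatives and a mass
term. For equal masses both are graded symmetric in the two labels, so the coefficients supply the
minus sign. -/
theorem smul_div_pairCurrent_antisymm {A B : Jet F} {c c' : ℂ}
    (hc : c = -(fieldSign odd A.1 B.1 * c')) (hm : c ≠ 0 → m A.1 = m B.1) :
    c • div odd m (pairCurrent odd m A B) = -(c' • div odd m (pairCurrent odd m B A)) := by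
  by_cases h0 : c = 0
  · have h1 : c' = 0 := by
      rw [h0] at hc
      have := neg_eq_zero.mp hc.symm
      refine (mul_eq_zero.mp this).resolve_left ?_
      unfold fieldSign
      split_ifs <;> norm_num
    simp [h0, h1]
  · have h : div odd m (pairCurrent odd m B A)
        = fieldSign odd A.1 B.1 • div odd m (pairCurrent odd m A B) := by
      rw [div_pairCurrent, div_pairCurrent, hm h0, smul_sub, Finset.smul_sum]
      congr 1
      · refine Finset.sum_congr rfl fun μ _ => ?_
        rw [y_mul_y odd m (B.diff μ), smul_comm, fieldSign_comm]
        rfl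
      · rw [y_mul_y odd m B, smul_comm, fieldSign_comm]
    rw [h, smul_smul, ← neg_smul, hc]
    congr 1
    ring

theorem div_finsupp_pair {c : Jet F × Jet F →₀ ℂ}
    (hc : ∀ A B, c (A, B) = -(fieldSign odd A.1 B.1 * c (B, A)))
    (hm : ∀ A B, c (A, B) ≠ 0 → m A.1 = m B.1) :
    div odd m (fun μ => c.sum fun AB a => a • (y odd m AB.1 * dUp odd m μ (y odd m AB.2))) = 0 := by
  classical
  have h : (fun μ => c.sum fun AB a => a • (y odd m AB.1 * dUp odd m μ (y odd m AB.2)))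
      = c.sum fun AB a => a • pairCurrent odd m AB.1 AB.2 := by
    funext μ
    rw [Finsupp.sum, Finsupp.sum, Finset.sum_apply]
    rfl
  -- The sum is extended to a square of labels, so that the antisymmetry under exchange of the two
  -- indices applies.
  let U : Finset (Jet F) := c.support.image Prod.fst ∪ c.support.image Prod.snd
  have hU : c.support ⊆ U ×ˢ U := fun p hp => Finset.mem_product.mpr
    ⟨Finset.mem_union_left _ (Finset.mem_image_of_mem _ hp),
      Finset.mem_union_right _ (Finset.mem_image_of_mem _ hp)⟩
  rw [h, Finsupp.sum_of_support_subset c hU _ (by simp), Finset.sum_product, map_sum]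
  simp only [map_sum, map_smul]
  exact sum_sum_eq_zero U fun A B => smul_div_pairCurrent_antisymm (hc A B) (hm A B)

theorem div_finsupp_linear {c : Jet F →₀ ℂ} (hm : ∀ A, c A ≠ 0 → m A.1 = 0) :
    div odd m (fun μ => c.sum fun A a => a • dUp odd m μ (y odd m A)) = 0 := by
  have h : (fun μ => c.sum fun A a => a • dUp odd m μ (y odd m A))
      = c.sum fun A a => a • linearCurrent odd m A := by
    funext μ
    rw [Finsupp.sum, Finsupp.sum, Finset.sum_apply]
    rfl
  rw [h, Finsupp.sum, map_sum]
  refine Finset.sum_eq_zero fun A hA => ?_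
  rw [map_smul, div_linearCurrent, hm A (Finsupp.mem_support_iff.mp hA)]
  simp

end Converse

end OnShellJets

end

/-! ### The four statements -/

theorem mainTheorem5 {F : Type*} [Fintype F] (odd : F → Bool) (m : F → ℝ≥0)
    {ι : Type*} (S : ι → Fin 4 → OnShellPoly odd m) :
    -- canonical dimension at least four, at least trilinear
    ((∀ I μ, S I μ ∈ dimGE odd m 4) → (∀ I μ, S I μ ∈ degGE odd m 3) → (∀ I, DivFree (S I)) →
      ∃ T : ι → Fin 4 → Fin 4 → OnShellPoly odd m,
        (∀ I, Antisymm (T I)) ∧ ∀ I μ, S I μ = divergence (T I) μ) ∧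
    -- canonical dimension at least four, no trilinearity
    ((∀ I μ, S I μ ∈ dimGE odd m 4) →
      ((∀ I, DivFree (S I)) ↔
        ∃ (c₂ : ι → Jet F × Jet F →₀ ℂ) (c₁ : ι → Jet F →₀ ℂ)
          (T : ι → Fin 4 → Fin 4 → OnShellPoly odd m),
          (∀ I A B, c₂ I (A, B) = -(fieldSign odd A.1 B.1 * c₂ I (B, A))) ∧
          (∀ I A B, c₂ I (A, B) ≠ 0 → m A.1 = m B.1) ∧
          (∀ I A, c₁ I A ≠ 0 → m A.1 = 0) ∧
          (∀ I, Antisymm (T I)) ∧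
          ∀ I μ, S I μ =
            (c₂ I).sum (fun AB c => c • (y odd m AB.1 * dUp odd m μ (y odd m AB.2))) +
            (c₁ I).sum (fun A c => c • dUp odd m μ (y odd m A)) +
            divergence (T I) μ)) ∧
    -- canonical dimension two
    ((∀ I μ, S I μ ∈ dimEq odd m 2) →
      ((∀ I, DivFree (S I)) ↔
        ∃ (c : ι → F → ℂ) (T : ι → Fin 4 → Fin 4 → OnShellPoly odd m),
          (∀ I α, c I α ≠ 0 → m α = 0) ∧
          (∀ I, Antisymm (T I)) ∧
          ∀ I μ, S I μ =
            ∑ α, c I α • dUp odd m μ (y odd m (α, 0)) + divergence (T I) μ)) ∧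
    -- canonical dimension three
    ((∀ I μ, S I μ ∈ dimEq odd m 3) →
      ((∀ I, DivFree (S I)) ↔
        ∃ (c₂ : ι → F → F → ℂ) (c₁ : ι → Fin 4 → F → ℂ)
          (T : ι → Fin 4 → Fin 4 → OnShellPoly odd m),
          (∀ I α β, c₂ I α β = -(fieldSign odd α β * c₂ I β α)) ∧
          (∀ I α β, c₂ I α β ≠ 0 → m α = m β) ∧
          (∀ I ν α, c₁ I ν α ≠ 0 → m α = 0) ∧
          (∀ I, Antisymm (T I)) ∧
          ∀ I μ, S I μ =
            ∑ α, ∑ β, c₂ I α β • (y odd m (α, 0) * dUp odd m μ (y odd m (β, 0))) +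
            ∑ α, ∑ ν, c₁ I ν α • dUp odd m μ (d odd m ν (y odd m (α, 0))) +
            divergence (T I) μ)) := by
  refine ⟨fun _ hdeg hdiv => ?_, fun hdim => ⟨fun hdiv => ?_, ?_⟩, fun hdim => ⟨fun hdiv => ?_, ?_⟩,
    fun hdim => ⟨fun hdiv => ?_, ?_⟩⟩
  · have h := fun I => current_form_many (fun _ hw => hw) (hdeg I) (hdiv I)
    choose T hT hS using h
    exact ⟨T, hT, hS⟩
  · have h := fun I => exists_coefficients (current_form (s := {l | 4 ≤ canonicalDim l})
      -- The bound on the canonical dimension rules out the empty word, that is, constant currents,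
      -- which are conserved.
      (fun w hw h0 => by
        have hw' : 4 ≤ canonicalDim w := hw
        rw [canonicalDim_eq_zero h0] at hw'
        omega) (hdim I) (hdiv I))
    choose c₂ c₁ T h1 h2 h3 h4 _ _ h5 using h
    exact ⟨c₂, c₁, T, h1, h2, h3, h4, h5⟩
  · rintro ⟨c₂, c₁, T, h1, h2, h3, h4, h5⟩ I
    have hS : S I = (fun μ => (c₂ I).sum fun AB c => c • (y odd m AB.1 * dUp odd m μ (y odd m AB.2)))
        + (fun μ => (c₁ I).sum fun A c => c • dUp odd m μ (y odd m A)) + divergence (T I) :=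
      funext (h5 I)
    rw [DivFree, ← div_apply, hS, map_add, map_add, div_finsupp_pair (h1 I) (h2 I),
      div_finsupp_linear (h3 I), div_divergence (h4 I), add_zero, add_zero]
  · have h := fun I => exists_coefficients (current_form_dimEq (k := 0) zero_le_one (hdim I) (hdiv I))
    choose c₂ c₁ T h1 h2 h3 h4 h6 h7 h5 using h
    refine ⟨fun I α => c₁ I (α, 0), T, fun I α => h3 I _, h4, fun I μ => ?_⟩
    -- `bilinearLabels F 0` is empty.
    have h0 : c₂ I = 0 := by
      ext ⟨A, B⟩
      by_contra hne
      rcases h6 I A B hne with h | h <;> exact zero_ne_one h.1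
    rw [h5, h0, Finsupp.sum_zero_index, zero_add,
      finsupp_sum_eq_sum_of_range (e := fun α : F => ((α, 0) : Jet F))
        (fun a b h => (Prod.mk.inj h).1) (fun A hA => ⟨A.1, Prod.ext rfl
          (Multiset.card_eq_zero.mp (h7 I A hA)).symm⟩) _ (by simp)]
  · rintro ⟨c, T, h3, h4, h5⟩ I
    have hS : S I = ∑ α, c I α • linearCurrent odd m (α, 0) + divergence (T I) := by
      funext μ
      rw [h5, Pi.add_apply, Finset.sum_apply]
      rfl
    rw [DivFree, ← div_apply, hS, map_add, map_sum, div_divergence (h4 I), add_zero]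
    refine Finset.sum_eq_zero fun α _ => ?_
    rw [map_smul, div_linearCurrent]
    by_cases h : c I α = 0
    · rw [h, zero_smul]
    · simp [h3 I α h]
  · have h := fun I => exists_coefficients (current_form_dimEq (k := 1) le_rfl (hdim I) (hdiv I))
    choose c₂ c₁ T h1 h2 h3 h4 h6 h7 h5 using h
    -- Bilinear labels carry no derivatives and linear labels exactly one, so the supports lie in
    -- the ranges of `(α, β) ↦ ((α, 0), (β, 0))` and `(α, ν) ↦ (α, {ν})`, and the finitely supported
    -- sums become sums over fields and indices.
    refine ⟨fun I α β => c₂ I ((α, 0), (β, 0)), fun I ν α => c₁ I (α, {ν}), T,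
      fun I α β => h1 I _ _, fun I α β => h2 I _ _, fun I ν α => h3 I _, h4, fun I μ => ?_⟩
    rw [h5, finsupp_sum_eq_sum_of_range (c := c₂ I)
        (e := fun p : F × F => (((p.1, 0), (p.2, 0)) : Jet F × Jet F))
        (fun a b h => by
          simp only [Prod.mk.injEq, and_true] at h
          exact Prod.ext h.1 h.2)
        (fun ⟨A, B⟩ hAB => ⟨(A.1, B.1), by
          have : A.2 = 0 ∧ B.2 = 0 := by
            rcases h6 I A B hAB with h | h
            · exact h.2
            · exact h.2.symm
          exact Prod.ext (Prod.ext rfl this.1.symm) (Prod.ext rfl this.2.symm)⟩) _ (by simp),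
      finsupp_sum_eq_sum_of_range (c := c₁ I)
        (e := fun p : F × Fin 4 => ((p.1, {p.2}) : Jet F))
        (fun a b h => by
          simp only [Prod.mk.injEq, Multiset.singleton_inj] at h
          exact Prod.ext h.1 h.2)
        (fun A hA => by
          obtain ⟨ν, hν⟩ := Multiset.card_eq_one.mp (h7 I A hA)
          exact ⟨(A.1, ν), Prod.ext rfl hν.symm⟩) _ (by simp),
      Fintype.sum_prod_type, Fintype.sum_prod_type]
    simp only [d_y]
    rfl
  · rintro ⟨c₂, c₁, T, h1, h2, h3, h4, h5⟩ I
    have hS : S I = ∑ α, ∑ β, c₂ I α β • pairCurrent odd m (α, 0) (β, 0)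
        + ∑ α, ∑ ν, c₁ I ν α • linearCurrent odd m (α, {ν}) + divergence (T I) := by
      funext μ
      simp only [h5, Pi.add_apply, Finset.sum_apply, d_y]
      rfl
    rw [DivFree, ← div_apply, hS, map_add, map_add, div_divergence (h4 I), add_zero]
    simp only [map_sum, map_smul]
    rw [sum_sum_eq_zero Finset.univ fun α β => smul_div_pairCurrent_antisymm (h1 I α β) (h2 I α β),
      zero_add]
    refine Finset.sum_eq_zero fun α _ => Finset.sum_eq_zero fun ν _ => ?_
    rw [div_linearCurrent]
    by_cases h : c₁ I ν α = 0
    · rw [h, zero_smul]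
    · simp [h3 I ν α h]
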